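/- Let $m,r\ge 1$, let $A_0,\dots,A_m\in\mathbb C^{n\times n}$ with $\operatorname{rank}(A_m)=n$, put $P(\lambda)=\sum_{j=0}^m\lambda^jA_j$, and let $\mathbb S=\{\lambda_1,\dots,\lambda_s\}$ be a finite set of complex numbers. For $\Delta\in\mathbb C^{n\times n}$ let $m_j(P+\Delta)$ be the multiplicity of $\lambda_j$ as a root of $\det(P(\lambda)+\Delta)$, and let $$\tau_r(\mathbb S)=\inf\Big\{\|\Delta\|_2:\ \Delta\in\mathbb C^{n\times n},\ \sum_{j=1}^s m_j(P+\Delta)\ge r\Big\}\in[0,\infty].$$ For $\mu\in\mathbb C^r$ and $\Gamma=(\gamma_{ki})_{1\le i<k\le r}\in\mathbb C^{r(r-1)/2}$ let $C(\mu,\Gamma)\in\mathbb C^{r\times r}$ be the upper triangular matrix with diagonal $\mu$ and with entry $\gamma_{ki}$ in position $(i,k)$ for $i<k$. Put $$\mathcal Q(\mu,\Gamma,P)=\sum_{j=0}^m\big(C(\mu,\Gamma)^j\big)^T\otimes A_j\in\mathbb C^{nr\times nr},\qquad \kappa_r(\mu)=\sup_{\Gamma\in\mathbb C^{r(r-1)/2}}\sigma_{-r}\big(\mathcal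 Q(\mu,\Gamma,P)\big)\in[0,\infty],$$ where $\sigma_{-r}$ denotes the $r$-th smallest singular value, counted with multiplicity. Attainment. Suppose $r\le n$ and $\mu\in\mathbb C^r$ is such that all divided differences $P[\mu_k,\mu_l]$, $k<l$, have rank $n$ (with $P[x,y]=(P(y)-P(x))/(y-x)$ for $x\ne y$ and $P[x,x]=P'(x)$). Then the supremum defining $\kappa_r(\mu)$ is attained. Let $\mu\in\mathbb S^r$ be a point where $\inf_{\nu\in\mathbb S^r}\kappa_r(\nu)$ is attained, and let $\Gamma_*$ be a point where the supremum defining $\kappa_r(\mu)$ is attained. Let $U=\operatorname{vec}(\mathcal U)$ and $V=\operatorname{vec}(\mathcal V)$, with $\mathcal U,\mathcal V\in\mathbb C^{n\times r}$ and $\operatorname{vec}$ stacking columns, be unit vectors with $$\mathcal Q(\mu,\Gamma_*,P)V=\kappa_r(\mu)U,\qquad U^*\mathcal Q(\mu,\Gamma_*,P)=\kappa_r(\mu)V^*.$$ Assume that the singular value $\sigma_{-r}(\mathcal Q(\mu,\Gamma_*,P))$ has multiplicity one (multiplicity assumption) and that $\operatorname{rank}(\mathcal V)=r$ (linear independence assumption).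 Then: (i) $\displaystyle \tau_r(\mathbb S)=\inf_{\nu\in\mathbb S^r}\ \sup_{\Gamma\in\mathbb C^{r(r-1)/2}}\sigma_{-r}\big(\mathcal Q(\nu,\Gamma,P)\big).$ (ii) The matrix $\Delta_*=-\kappa_r(\mu)\,\mathcal U\mathcal V^+$, where $\mathcal V^+$ is the Moore–Penrose inverse, satisfies $\sum_{j=1}^s m_j(P+\Delta_*)\ge r$ and $\|\Delta_*\|_2=\tau_r(\mathbb S)$. Thus it is of minimal 2-norm among all $\Delta\in\mathbb C^{n\times n}$ with $\sum_{j=1}^s m_j(P+\Delta)\ge r$. -/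

import Mathlib

open scoped ENNReal Kronecker Matrix

namespace SpecEig

noncomputable section

/-- The matrix polynomial `P(λ) = ∑_{j=0}^m λ^j A_j`, as a matrix with polynomial entries. -/
def matPoly {n m : ℕ} (A : Fin (m + 1) → Matrix (Fin n) (Fin n) ℂ) :
    Matrix (Fin n) (Fin n) (Polynomial ℂ) :=
  ∑ j : Fin (m + 1), (Polynomial.X ^ (j : ℕ) : Polynomial ℂ) • (A j).map Polynomial.C

/-- Algebraic multiplicity of `z` as an eigenvalue of `P + Δ`: its multiplicity as a root of
`det (P(λ) + Δ)`. -/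
def algMult {n m : ℕ} (A : Fin (m + 1) → Matrix (Fin n) (Fin n) ℂ)
    (Δ : Matrix (Fin n) (Fin n) ℂ) (z : ℂ) : ℕ :=
  Polynomial.rootMultiplicity z (matPoly A + Δ.map Polynomial.C).det

/-- `P + Δ` has at least `r` eigenvalues in `S`, counted with algebraic multiplicity. -/
def Feasible {n m : ℕ} (A : Fin (m + 1) → Matrix (Fin n) (Fin n) ℂ) (S : Finset ℂ) (r : ℕ)
    (Δ : Matrix (Fin n) (Fin n) ℂ) : Prop :=
  r ≤ ∑ z ∈ S, algMult A Δ z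

/-- The matrix 2-norm: the operator norm for the Euclidean norm on `ℂⁿ`. -/
def norm2 {n : ℕ} (Δ : Matrix (Fin n) (Fin n) ℂ) : ℝ :=
  ‖Matrix.toEuclideanCLM (n := Fin n) (𝕜 := ℂ) Δ‖

/-- The distance `τ_r(S)`, with value `∞` when no perturbation is feasible. -/
def tau {n m : ℕ} (A : Fin (m + 1) → Matrix (Fin n) (Fin n) ℂ) (S : Finset ℂ) (r : ℕ) : ℝ≥0∞ :=
  ⨅ (Δ : Matrix (Fin n) (Fin n) ℂ) (_ : Feasible A S r Δ), ENNReal.ofReal (norm2 Δ)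

/-- Positions strictly above the diagonal of an `r × r` matrix; there are `r(r-1)/2` of them. -/
abbrev StrictUpper (r : ℕ) : Type := {p : Fin r × Fin r // p.1 < p.2}

/-- The upper triangular matrix `C(μ, Γ)` with diagonal `μ` and strictly upper part `Γ`. -/
def Cmat {r : ℕ} (μ : Fin r → ℂ) (Γ : StrictUpper r → ℂ) : Matrix (Fin r) (Fin r) ℂ :=
  Matrix.of fun i j => if i = j then μ i else if h : i < j then Γ ⟨(i, j), h⟩ else 0

/-- `Q(μ, Γ, P) = ∑_j (C(μ, Γ)^j)ᵀ ⊗ A_j`. -/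
def Qmat {n m r : ℕ} (A : Fin (m + 1) → Matrix (Fin n) (Fin n) ℂ) (μ : Fin r → ℂ)
    (Γ : StrictUpper r → ℂ) : Matrix (Fin r × Fin n) (Fin r × Fin n) ℂ :=
  ∑ j : Fin (m + 1), (Cmat μ Γ ^ (j : ℕ))ᵀ ⊗ₖ A j

/-- The singular values of a square matrix in decreasing order, indexed from `0`. -/
def singVal {ι : Type} [Fintype ι] [DecidableEq ι] (B : Matrix ι ι ℂ) (i : ℕ) : ℝ :=
  (Matrix.toEuclideanLin B).singularValues i

/-- The `k`-th smallest singular value `σ_{-k}(B)`, for `1 ≤ k ≤ card ι`. -/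
def sigmaNeg {ι : Type} [Fintype ι] [DecidableEq ι] (k : ℕ) (B : Matrix ι ι ℂ) : ℝ :=
  singVal B (Fintype.card ι - k)

/-- The multiplicity of the real number `s` as a singular value of `B`. -/
def singValMult {ι : Type} [Fintype ι] [DecidableEq ι] (B : Matrix ι ι ℂ) (s : ℝ) : ℕ :=
  Set.ncard {i : ℕ | i < Fintype.card ι ∧ singVal B i = s}

/-- `κ_r(μ) = sup_Γ σ_{-r}(Q(μ, Γ, P))`, possibly `∞`. -/
def kappa {n m r : ℕ} (A : Fin (m + 1) → Matrix (Fin n) (Fin n) ℂ) (μ : Fin r → ℂ) : ℝ≥0∞ :=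
  ⨆ Γ : StrictUpper r → ℂ, ENNReal.ofReal (sigmaNeg r (Qmat A μ Γ))

/-- The supremum defining `κ_r(μ)` is attained at `Γ`. -/
def AttainedAt {n m r : ℕ} (A : Fin (m + 1) → Matrix (Fin n) (Fin n) ℂ) (μ : Fin r → ℂ)
    (Γ : StrictUpper r → ℂ) : Prop :=
  kappa A μ = ENNReal.ofReal (sigmaNeg r (Qmat A μ Γ))

/-- `μ ∈ S^r` and the infimum of `κ_r` over `S^r` is attained at `μ`. -/
def OuterOptimal {n m r : ℕ} (A : Fin (m + 1) → Matrix (Fin n) (Fin n) ℂ) (S : Finset ℂ)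
    (μ : Fin r → ℂ) : Prop :=
  (∀ i, μ i ∈ S) ∧ ∀ ν : Fin r → ℂ, (∀ i, ν i ∈ S) → kappa A μ ≤ kappa A ν

/-- `vec U`, `vec V` is a consistent pair of unit left and right singular vectors of `Q` for the
singular value `s`; `vec` stacks columns. -/
def SingularPair {n r : ℕ} (Q : Matrix (Fin r × Fin n) (Fin r × Fin n) ℂ) (s : ℝ)
    (U V : Matrix (Fin n) (Fin r) ℂ) : Prop :=
  ‖WithLp.toLp 2 U.vec‖ = 1 ∧ ‖WithLp.toLp 2 V.vec‖ = 1 ∧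
    Q *ᵥ V.vec = (s : ℂ) • U.vec ∧ star U.vec ᵥ* Q = (s : ℂ) • star V.vec

/-- The Moore-Penrose inverse `V⁺ = (VᴴV)⁻¹Vᴴ` of a matrix with full column rank. -/
def pinv {n r : ℕ} (V : Matrix (Fin n) (Fin r) ℂ) : Matrix (Fin r) (Fin n) ℂ :=
  (Vᴴ * V)⁻¹ * Vᴴ

open scoped ComplexOrder in
/-- For full column rank, `pinv V` satisfies the four Penrose equations. -/
theorem pinv_penrose {n r : ℕ} (V : Matrix (Fin n) (Fin r) ℂ) (hV : V.rank = r) :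
    V * pinv V * V = V ∧ pinv V * V * pinv V = pinv V ∧
      (V * pinv V)ᴴ = V * pinv V ∧ (pinv V * V)ᴴ = pinv V * V := by
  have hu : IsUnit (Vᴴ * V) := by
    rw [← Matrix.mulVec_injective_iff_isUnit, ← Matrix.coe_mulVecLin]
    have h : (Vᴴ * V).rank = r := by rw [Matrix.rank_conjTranspose_mul_self, hV]
    rw [LinearMap.injective_iff_surjective, ← LinearMap.range_eq_top]
    apply Submodule.eq_top_of_finrank_eq
    rw [← Matrix.rank, h]; simp
  have hd : IsUnit (Vᴴ * V).det := (Matrix.isUnit_iff_isUnit_det _).1 hu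
  have h1 : pinv V * V = 1 := by
    rw [pinv, Matrix.mul_assoc, Matrix.nonsing_inv_mul _ hd]
  refine ⟨by rw [Matrix.mul_assoc, h1, Matrix.mul_one], by rw [h1, Matrix.one_mul], ?_,
    by rw [h1, Matrix.conjTranspose_one]⟩
  simp only [pinv, Matrix.conjTranspose_mul, Matrix.conjTranspose_nonsing_inv,
    Matrix.conjTranspose_conjTranspose, Matrix.mul_assoc]

/-- The perturbation `Δ_* = -κ_r(μ) U V⁺`. -/
def optPert {n m r : ℕ} (A : Fin (m + 1) → Matrix (Fin n) (Fin n) ℂ) (μ : Fin r → ℂ)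
    (U V : Matrix (Fin n) (Fin r) ℂ) : Matrix (Fin n) (Fin n) ℂ :=
  -(((kappa A μ).toReal : ℂ) • (U * pinv V))

/-- The divided difference `P[x, y]`: it is `(P(y) - P(x)) / (y - x)` for `x ≠ y` and `P'(x)` for
`x = y`, because `(y^j - x^j) / (y - x) = ∑_{i<j} x^i y^{j-1-i}`. -/
def divDiff {n m : ℕ} (A : Fin (m + 1) → Matrix (Fin n) (Fin n) ℂ) (x y : ℂ) :
    Matrix (Fin n) (Fin n) ℂ :=
  ∑ j : Fin (m + 1), (∑ i ∈ Finset.range j, x ^ i * y ^ ((j : ℕ) - 1 - i)) • A j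

end

end SpecEig

open SpecEig

open scoped ENNReal Kronecker Matrix

/-! Lower bound: let `Δ` be feasible. Then `r` roots of `det (P + Δ)` lying in `S` form a tuple `ν`
whose product `∏ (X - ν i)` divides the determinant. This product is the characteristic polynomial
of `C(ν, Γ)` for every `Γ`, so by Cayley-Hamilton the transpose of `C(ν, Γ)` annihilates `det (P +
Δ)`. Diagonalizing `P + Δ` over `ℂ[X]` then shows that `Q + 1 ⊗ Δ` has nullity at least `r`
(`rank_substHom_add_le`), and Courant-Fischer gives `σ_{-r}(Q) ≤ ‖Δ‖` for all `Γ`. Hence `inf κ ≤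
τ`.

Upper bound: with `K = C(μ, Γ_*)` and `s = κ(μ)`, the equation `Q vec V = s vec U` says `∑ A_j V K^j
= s U = -Δ_* V`. So `(V, K)` is an invariant pair of `P + Δ_*`, and `K.charpoly` divides its
determinant, which is nonzero because `A_m` is invertible; thus `Δ_*` is feasible. For the norm,
stationarity of the simple singular value at the maximizer makes a certain matrix `M` upper
triangular, while the two singular vector equations give `M K - K M = s (Uᴴ U - Vᴴ V)`. A commutator
of upper triangular matrices is strictly upper triangular and the right side is Hermitian, so for `s
> 0` both vanish (`gram_eq`). Then `U V⁺` is a partial isometry and `‖Δ_*‖ ≤ s`. The chain `κ(μ) ≤ τ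
≤ ‖Δ_*‖ ≤ κ(μ)` closes.

Attainment: a superlevel set of `σ_{-r}` at a positive level is bounded, one superdiagonal at a time
(`exists_entry_bound`). A large entry of `Γ` allows a perturbation of inverse size that creates a
kernel of dimension `n ≥ r`; invertibility of the divided differences is what makes this work. -/

namespace SpecEig

/-! ### Courant-Fischer bounds and first order variation of singular values. -/

section SingularValues

open Module Filter Topology

variable {E : Type*} [NormedAddCommGroup E] [InnerProductSpace ℂ E] [FiniteDimensional ℂ E]

/-- An orthonormal basis of right singular vectors. -/
noncomputable def singBasis (T : E →ₗ[ℂ] E) : OrthonormalBasis (Fin (finrank ℂ E)) ℂ E :=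
  T.isSymmetric_adjoint_comp_self.eigenvectorBasis rfl

theorem adjoint_apply_singBasis (T : E →ₗ[ℂ] E) (i : Fin (finrank ℂ E)) :
    T.adjoint (T (singBasis T i)) = ((T.singularValues i ^ 2 : ℝ) : ℂ) • singBasis T i := by
  rw [T.sq_singularValues_fin rfl i]
  exact T.isSymmetric_adjoint_comp_self.apply_eigenvectorBasis rfl i

theorem norm_sq_apply_eq_sum (T : E →ₗ[ℂ] E) (x : E) :
    ‖T x‖ ^ 2 = ∑ i : Fin (finrank ℂ E), T.singularValues i ^ 2 * ‖(singBasis T).repr x i‖ ^ 2 := by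
  have h : ∀ i, (singBasis T).repr (T.adjoint (T x)) i =
      ((T.singularValues i ^ 2 : ℝ) : ℂ) * (singBasis T).repr x i := by
    intro i
    rw [T.sq_singularValues_fin rfl i]
    exact T.isSymmetric_adjoint_comp_self.eigenvectorBasis_apply_self_apply rfl x i
  have h2 : (inner ℂ (T x) (T x) : ℂ) = inner ℂ x (T.adjoint (T x)) := by
    rw [LinearMap.adjoint_inner_right]
  rw [inner_self_eq_norm_sq_to_K, ← (singBasis T).repr.inner_map_map, PiLp.inner_apply] at h2
  have h3 := congrArg Complex.re h2
  rw [Complex.re_sum] at h3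
  have h4 : (((‖T x‖ : ℝ) : ℂ) ^ 2).re = ‖T x‖ ^ 2 := by
    rw [← Complex.ofReal_pow, Complex.ofReal_re]
  refine h4.symm.trans (h3.trans (Finset.sum_congr rfl fun i _ => ?_))
  rw [h i, ← smul_eq_mul, inner_smul_right, inner_self_eq_norm_sq_to_K]
  change (((T.singularValues i ^ 2 : ℝ) : ℂ) * ((‖(singBasis T).repr x i‖ : ℝ) : ℂ) ^ 2).re = _
  rw [← Complex.ofReal_pow, ← Complex.ofReal_mul, Complex.ofReal_re]

theorem norm_sq_eq_sum_singBasis (T : E →ₗ[ℂ] E) (x : E) :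
    ‖x‖ ^ 2 = ∑ i, ‖(singBasis T).repr x i‖ ^ 2 := by
  rw [← (singBasis T).repr.norm_map, EuclideanSpace.norm_sq_eq]

/-- The span of the right singular vectors with indices in `s`. -/
noncomputable def singSpan (T : E →ₗ[ℂ] E) (s : Finset (Fin (finrank ℂ E))) : Submodule ℂ E :=
  Submodule.span ℂ (Set.range fun i : s => singBasis T i)

theorem finrank_singSpan (T : E →ₗ[ℂ] E) (s : Finset (Fin (finrank ℂ E))) :
    finrank ℂ (singSpan T s) = s.card := by
  rw [singSpan, finrank_span_eq_card, Fintype.card_coe]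
  exact ((singBasis T).orthonormal.comp _ Subtype.val_injective).linearIndependent

theorem repr_eq_zero_of_mem_singSpan {T : E →ₗ[ℂ] E} {s : Finset (Fin (finrank ℂ E))} {x : E}
    (hx : x ∈ singSpan T s) {i : Fin (finrank ℂ E)} (hi : i ∉ s) :
    (singBasis T).repr x i = 0 := by
  rw [OrthonormalBasis.repr_apply_apply]
  refine Submodule.span_induction (p := fun y _ => inner ℂ (singBasis T i) y = 0) ?_ ?_ ?_ ?_ hx
  · rintro _ ⟨j, rfl⟩
    exact (singBasis T).orthonormal.2 (fun h => hi (h ▸ j.2))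
  · simp
  · intro a b _ _ ha hb
    rw [inner_add_right, ha, hb, add_zero]
  · intro a b _ hb
    rw [inner_smul_right, hb, mul_zero]

theorem exists_tail_subspace (T : E →ₗ[ℂ] E) (k : ℕ) :
    ∃ W : Submodule ℂ E, finrank ℂ W = finrank ℂ E - k ∧
      ∀ x ∈ W, ‖T x‖ ≤ T.singularValues k * ‖x‖ := by
  refine ⟨singSpan T {i | k ≤ (i : ℕ)}, ?_, fun x hx => ?_⟩
  · rw [finrank_singSpan]
    have := Fin.card_filter_val_lt (n := finrank ℂ E) (m := k)
    have h2 := Finset.card_filter_add_card_filter_not (s := (Finset.univ : Finset (Fin (finrank ℂ E))))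
      (fun i => (i : ℕ) < k)
    simp only [not_lt, Finset.card_univ, Fintype.card_fin] at h2
    omega
  · refine le_of_sq_le_sq ?_ (mul_nonneg (T.singularValues_nonneg k) (norm_nonneg x))
    rw [mul_pow, norm_sq_apply_eq_sum, norm_sq_eq_sum_singBasis T, Finset.mul_sum]
    refine Finset.sum_le_sum fun i _ => ?_
    by_cases hi : k ≤ (i : ℕ)
    · gcongr
      · exact T.singularValues_nonneg i
      · exact T.singularValues_antitone hi
    · rw [repr_eq_zero_of_mem_singSpan hx (by simpa using hi)]
      simp

theorem exists_head_subspace (T : E →ₗ[ℂ] E) {k : ℕ} (hk : k < finrank ℂ E) :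
    ∃ W : Submodule ℂ E, finrank ℂ W = k + 1 ∧
      ∀ x ∈ W, T.singularValues k * ‖x‖ ≤ ‖T x‖ := by
  refine ⟨singSpan T {i | (i : ℕ) < k + 1}, ?_, fun x hx => ?_⟩
  · rw [finrank_singSpan, Fin.card_filter_val_lt]
    omega
  · refine le_of_sq_le_sq ?_ (norm_nonneg _)
    rw [mul_pow, norm_sq_apply_eq_sum, norm_sq_eq_sum_singBasis T, Finset.mul_sum]
    refine Finset.sum_le_sum fun i _ => ?_
    by_cases hi : (i : ℕ) < k + 1
    · gcongr
      · exact T.singularValues_nonneg k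
      · exact T.singularValues_antitone (by omega)
    · rw [repr_eq_zero_of_mem_singSpan hx (by simpa using hi)]
      simp

/-- The gap gives strictness. It also gives orthogonality to every eigenvector `v` of `T* T` for
`σ_k²`, whether or not `v` belongs to the chosen basis, since eigenvectors for distinct eigenvalues
are orthogonal. -/
theorem exists_strict_head_subspace (T : E →ₗ[ℂ] E) {k : ℕ} (hk : k < finrank ℂ E)
    (hgap : ∀ i < k, T.singularValues k < T.singularValues i) :
    ∃ W : Submodule ℂ E, finrank ℂ W = k ∧
      (∀ x ∈ W, x ≠ 0 → T.singularValues k * ‖x‖ < ‖T x‖) ∧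
      ∀ v, T.adjoint (T v) = ((T.singularValues k ^ 2 : ℝ) : ℂ) • v →
        ∀ x ∈ W, inner ℂ x v = 0 := by
  refine ⟨singSpan T {i | (i : ℕ) < k}, ?_, fun x hx hx0 => ?_, fun v hv x hx => ?_⟩
  · rw [finrank_singSpan, Fin.card_filter_val_lt]
    omega
  · refine lt_of_pow_lt_pow_left₀ 2 (norm_nonneg _) ?_
    rw [mul_pow, norm_sq_apply_eq_sum, norm_sq_eq_sum_singBasis T, Finset.mul_sum]
    have hne : ∃ i, (singBasis T).repr x i ≠ 0 := by
      by_contra! h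
      exact hx0 ((singBasis T).repr.map_eq_zero_iff.1 (by ext i; simpa using h i))
    have key : ∀ i, (i : ℕ) < k → T.singularValues k ^ 2 < T.singularValues i ^ 2 := fun i hi =>
      pow_lt_pow_left₀ (hgap i hi) (T.singularValues_nonneg k) two_ne_zero
    obtain ⟨i₀, hi₀⟩ := hne
    refine Finset.sum_lt_sum (fun i _ => ?_) ⟨i₀, Finset.mem_univ _, ?_⟩
    · by_cases hi : (i : ℕ) < k
      · exact mul_le_mul_of_nonneg_right (key i hi).le (sq_nonneg _)
      · rw [repr_eq_zero_of_mem_singSpan hx (by simpa using hi)]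
        simp
    · have hi : (i₀ : ℕ) < k := by
        by_contra hi
        exact hi₀ (repr_eq_zero_of_mem_singSpan hx (by simpa using hi))
      exact mul_lt_mul_of_pos_right (key i₀ hi) (by positivity)
  · refine Submodule.span_induction (p := fun y _ => inner ℂ y v = 0) ?_ ?_ ?_ ?_ hx
    · rintro _ ⟨⟨j, hj⟩, rfl⟩
      have hj' : (j : ℕ) < k := by simpa using hj
      have h1 : (inner ℂ (T.adjoint (T (singBasis T j))) v : ℂ) =
          inner ℂ (singBasis T j) (T.adjoint (T v)) := by
        rw [LinearMap.adjoint_inner_left, LinearMap.adjoint_inner_right]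
      rw [adjoint_apply_singBasis, hv, inner_smul_left, inner_smul_right, Complex.conj_ofReal,
        ← sub_eq_zero, ← sub_mul, ← Complex.ofReal_sub] at h1
      refine (mul_eq_zero.1 h1).resolve_left ?_
      have := pow_lt_pow_left₀ (hgap j hj') (T.singularValues_nonneg k) two_ne_zero
      exact Complex.ofReal_ne_zero.2 (sub_pos.2 this).ne'
    · simp
    · intro a b _ _ ha hb
      rw [inner_add_left, ha, hb, add_zero]
    · intro a b _ hb
      rw [inner_smul_left, hb, mul_zero]

theorem exists_ne_zero_mem_inf {W W' : Submodule ℂ E}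
    (h : finrank ℂ E < finrank ℂ W + finrank ℂ W') : ∃ x ∈ W, x ∈ W' ∧ x ≠ 0 := by
  have h1 := Submodule.finrank_sup_add_finrank_inf_eq W W'
  have h2 := (W ⊔ W').finrank_le
  have h3 : W ⊓ W' ≠ ⊥ := by
    intro h0
    rw [h0, finrank_bot] at h1
    omega
  obtain ⟨x, hx, hx0⟩ := Submodule.exists_mem_ne_zero_of_ne_bot h3
  exact ⟨x, hx.1, hx.2, hx0⟩

/-- The easy half of the Courant-Fischer principle. -/
theorem singularValues_le_of_subspace (T : E →ₗ[ℂ] E) {k : ℕ} {s : ℝ} (hs : 0 ≤ s)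
    (W : Submodule ℂ E) (hW : finrank ℂ E ≤ finrank ℂ W + k) (h : ∀ x ∈ W, ‖T x‖ ≤ s * ‖x‖) :
    T.singularValues k ≤ s := by
  by_cases hk : k < finrank ℂ E
  · obtain ⟨W', hW', h'⟩ := exists_head_subspace T hk
    obtain ⟨x, hx, hx', hx0⟩ := exists_ne_zero_mem_inf (W := W) (W' := W') (by omega)
    exact le_of_mul_le_mul_right ((h' x hx').trans (h x hx)) (norm_pos_iff.2 hx0)
  · rw [T.singularValues_of_finrank_le (not_lt.1 hk)]
    exact hs

/-- Weyl's perturbation inequality: the tail subspace of `T` serves as test subspace for `T'`. -/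
theorem singularValues_le_add (T T' : E →L[ℂ] E) (k : ℕ) :
    (T' : E →ₗ[ℂ] E).singularValues k ≤ (T : E →ₗ[ℂ] E).singularValues k + ‖T' - T‖ := by
  obtain ⟨W, hW, h⟩ := exists_tail_subspace (T : E →ₗ[ℂ] E) k
  refine singularValues_le_of_subspace _
    (add_nonneg (LinearMap.singularValues_nonneg _ _) (norm_nonneg _)) W (by omega) fun x hx => ?_
  have h1 : (T' : E →ₗ[ℂ] E) x = T x + (T' - T) x := by simp
  rw [h1, add_mul]
  exact (norm_add_le _ _).trans (add_le_add (h x hx) ((T' - T).le_opNorm x))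

theorem continuous_singularValues (k : ℕ) :
    Continuous fun T : E →L[ℂ] E => (T : E →ₗ[ℂ] E).singularValues k := by
  refine (LipschitzWith.of_le_add fun T T' => ?_ :
    LipschitzWith 1 fun T : E →L[ℂ] E => (T : E →ₗ[ℂ] E).singularValues k).continuous
  rw [dist_eq_norm]
  exact singularValues_le_add T' T k

/-- First order optimality: if a singular value that is separated from the larger ones does not
increase along `T + tₙ Bₙ` with `tₙ ↓ 0` and `Bₙ → B`, then `Re ⟪T v, B v⟫ ≤ 0`. -/
theorem re_inner_nonpos_of_singularValues_le (T B : E →L[ℂ] E) {k : ℕ} (hk : k < finrank ℂ E)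
    (hgap : ∀ i < k, (T : E →ₗ[ℂ] E).singularValues k < (T : E →ₗ[ℂ] E).singularValues i)
    {v : E} (hv : ‖v‖ = 1) (hTv : (T : E →ₗ[ℂ] E).adjoint (T v) =
      (((T : E →ₗ[ℂ] E).singularValues k ^ 2 : ℝ) : ℂ) • v)
    (t : ℕ → ℝ) (ht : ∀ j, 0 < t j) (ht0 : Tendsto t atTop (𝓝 0))
    (B' : ℕ → E →L[ℂ] E) (hB : Tendsto B' atTop (𝓝 B))
    (hle : ∀ j, ((T + (t j : ℂ) • B' j : E →L[ℂ] E) : E →ₗ[ℂ] E).singularValues k ≤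
      (T : E →ₗ[ℂ] E).singularValues k) :
    (inner ℂ (T v) (B v)).re ≤ 0 := by
  set s := (T : E →ₗ[ℂ] E).singularValues k with hs
  have hs0 : 0 ≤ s := LinearMap.singularValues_nonneg _ _
  obtain ⟨H, hH, hH1, hH2⟩ := exists_strict_head_subspace (T : E →ₗ[ℂ] E) hk hgap
  have hHv := hH2 v hTv
  have hv0 : v ≠ 0 := norm_ne_zero_iff.1 (by rw [hv]; exact one_ne_zero)
  -- the quadratic form on `H ⊔ ⟨v⟩`
  have hdecomp : ∀ h ∈ H, ∀ a : ℂ, ‖T (h + a • v)‖ ^ 2 = ‖T h‖ ^ 2 + s ^ 2 * ‖a‖ ^ 2 ∧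
      ‖h + a • v‖ ^ 2 = ‖h‖ ^ 2 + ‖a‖ ^ 2 := by
    intro h hh a
    have e1 : (inner ℂ (T h) (T (a • v)) : ℂ) = 0 := by
      have : (inner ℂ (T h) (T v) : ℂ) = inner ℂ h ((T : E →ₗ[ℂ] E).adjoint (T v)) := by
        rw [LinearMap.adjoint_inner_right]; rfl
      rw [map_smul, inner_smul_right, this, hTv, inner_smul_right, hHv h hh]
      simp
    have e2 : (inner ℂ h (a • v) : ℂ) = 0 := by
      rw [inner_smul_right, hHv h hh, mul_zero]
    have e3 : ‖T v‖ ^ 2 = s ^ 2 := by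
      have : (inner ℂ (T v) (T v) : ℂ) = inner ℂ v ((T : E →ₗ[ℂ] E).adjoint (T v)) := by
        rw [LinearMap.adjoint_inner_right]; rfl
      rw [hTv, inner_smul_right, inner_self_eq_norm_sq_to_K, inner_self_eq_norm_sq_to_K, hv] at this
      simp only [Complex.coe_algebraMap, Complex.ofReal_one, one_pow, mul_one] at this
      exact_mod_cast this
    constructor
    · rw [map_add, pow_two, norm_add_sq_eq_norm_sq_add_norm_sq_of_inner_eq_zero _ _ e1, map_smul,
        norm_smul, ← e3]
      ring
    · rw [pow_two, norm_add_sq_eq_norm_sq_add_norm_sq_of_inner_eq_zero _ _ e2, norm_smul, hv]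
      ring
  have hvH : v ∉ H := fun hmem => hv0 (inner_self_eq_zero.1 (hHv v hmem))
  have hfin : finrank ℂ (H ⊔ Submodule.span ℂ {v} : Submodule ℂ E) = k + 1 := by
    have h1 := Submodule.finrank_sup_add_finrank_inf_eq H (Submodule.span ℂ {v})
    have h2 : H ⊓ Submodule.span ℂ {v} = ⊥ := by
      rw [← disjoint_iff]
      exact (Submodule.disjoint_span_singleton' hv0).2 hvH
    rw [h2, finrank_bot, finrank_span_singleton hv0, hH] at h1
    simpa using h1
  have hmem : ∀ w ∈ H ⊔ Submodule.span ℂ {v}, ∃ h ∈ H, ∃ a : ℂ, w = h + a • v := by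
    intro w hw
    obtain ⟨h, hh, z, hz, rfl⟩ := Submodule.mem_sup.1 hw
    obtain ⟨a, rfl⟩ := Submodule.mem_span_singleton.1 hz
    exact ⟨h, hh, a, rfl⟩
  have hlow : ∀ w ∈ H ⊔ Submodule.span ℂ {v}, s ^ 2 * ‖w‖ ^ 2 ≤ ‖T w‖ ^ 2 := by
    intro w hw
    obtain ⟨h, hh, a, rfl⟩ := hmem w hw
    rw [(hdecomp h hh a).1, (hdecomp h hh a).2, mul_add]
    gcongr
    rw [← mul_pow]
    by_cases h0 : h = 0
    · simp [h0]
    · exact pow_le_pow_left₀ (by positivity) (hH1 h hh h0).le 2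
  -- The space `H ⊔ ⟨v⟩` has dimension `k + 1`, so it meets the tail subspace of the perturbed
  -- operator, whose codimension is at most `k`.
  have hw : ∀ j, ∃ w ∈ H ⊔ Submodule.span ℂ {v}, ‖w‖ = 1 ∧ ‖T w + (t j : ℂ) • B' j w‖ ≤ s := by
    intro j
    obtain ⟨W, hW, hW'⟩ :=
      exists_tail_subspace ((T + (t j : ℂ) • B' j : E →L[ℂ] E) : E →ₗ[ℂ] E) k
    obtain ⟨x, hx, hx', hx0⟩ := exists_ne_zero_mem_inf (W := H ⊔ Submodule.span ℂ {v}) (W' := W)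
      (by omega)
    have hn : ‖((‖x‖ : ℂ)⁻¹) • x‖ = 1 := by
      rw [norm_smul, norm_inv, Complex.norm_real, norm_norm, inv_mul_cancel₀ (norm_ne_zero_iff.2 hx0)]
    refine ⟨((‖x‖ : ℂ)⁻¹) • x, Submodule.smul_mem _ _ hx, hn, ?_⟩
    have := hW' _ (Submodule.smul_mem _ ((‖x‖ : ℂ)⁻¹) hx')
    rw [hn, mul_one] at this
    exact this.trans (hle j)
  choose w hwW hw1 hwT using hw
  -- Expand `‖T w + t B' w‖² ≤ s² ≤ ‖T w‖²`: the cross term cannot be positive.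
  have hre : ∀ j, (inner ℂ (T (w j)) (B' j (w j))).re ≤ 0 := by
    intro j
    have h1 := hlow _ (hwW j)
    rw [hw1, one_pow, mul_one] at h1
    have h2 := pow_le_pow_left₀ (norm_nonneg _) (hwT j) 2
    have h3 := norm_add_sq (𝕜 := ℂ) (T (w j)) ((t j : ℂ) • B' j (w j))
    rw [inner_smul_right, RCLike.re_eq_complex_re, Complex.re_ofReal_mul] at h3
    have h4 := sq_nonneg ‖(t j : ℂ) • B' j (w j)‖
    have h5 : t j * (inner ℂ (T (w j)) (B' j (w j))).re ≤ 0 := by linarith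
    exact nonpos_of_mul_nonpos_right h5 (ht j)
  have : ProperSpace E := FiniteDimensional.proper ℂ E
  obtain ⟨w₀, hw₀, φ, hφ, hlim⟩ := (isCompact_sphere (0 : E) 1).tendsto_subseq
    (x := w) (fun j => by simp [hw1 j])
  have hw₀1 : ‖w₀‖ = 1 := by simpa using hw₀
  have hw₀W : w₀ ∈ H ⊔ Submodule.span ℂ {v} :=
    (Submodule.closed_of_finiteDimensional (H ⊔ Submodule.span ℂ {v})).mem_of_tendsto hlim
      (Eventually.of_forall fun j => hwW _)
  have hBw : Tendsto (fun j => B' (φ j) (w (φ j))) atTop (𝓝 (B w₀)) :=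
    (isBoundedBilinearMap_apply.continuous.tendsto (B, w₀)).comp
      ((hB.comp hφ.tendsto_atTop).prodMk_nhds hlim)
  have hTw : Tendsto (fun j => T (w (φ j))) atTop (𝓝 (T w₀)) := (T.continuous.tendsto w₀).comp hlim
  have htφ : Tendsto (fun j => ((t (φ j) : ℝ) : ℂ)) atTop (𝓝 ((0 : ℝ) : ℂ)) :=
    (Complex.continuous_ofReal.tendsto 0).comp (ht0.comp hφ.tendsto_atTop)
  have hnorm : ‖T w₀‖ ≤ s := by
    have h1 := hTw.add (htφ.smul hBw)
    rw [Complex.ofReal_zero, zero_smul, add_zero] at h1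
    exact le_of_tendsto h1.norm (Eventually.of_forall fun j => hwT _)
  have hre₀ : (inner ℂ (T w₀) (B w₀)).re ≤ 0 :=
    le_of_tendsto ((Complex.continuous_re.tendsto _).comp (hTw.inner hBw))
      (Eventually.of_forall fun j => hre _)
  obtain ⟨h, hh, a, rfl⟩ := hmem w₀ hw₀W
  -- The limit satisfies `‖T w₀‖ ≤ s`, while `T` stretches nonzero vectors of `H` by strictly more
  -- than `s`. So `w₀` is a unimodular multiple of `v`, and the factor cancels in the inner product.
  have hh0 : h = 0 := by
    by_contra h0
    have h1 := hdecomp h hh a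
    have h2 := pow_lt_pow_left₀ (hH1 h hh h0) (by positivity) two_ne_zero
    have h3 := pow_le_pow_left₀ (norm_nonneg _) hnorm 2
    rw [hw₀1] at h1
    rw [mul_pow] at h2
    have h4 : ‖(T : E →ₗ[ℂ] E) h‖ = ‖T h‖ := rfl
    rw [h4] at h2
    nlinarith [h1.1, h1.2]
  subst hh0
  have ha : ‖a‖ = 1 := by simpa [norm_smul, hv] using hw₀1
  rw [zero_add, map_smul, map_smul, inner_smul_left, inner_smul_right, ← mul_assoc,
    ← Complex.normSq_eq_conj_mul_self, Complex.normSq_eq_norm_sq, ha] at hre₀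
  simpa using hre₀

end SingularValues

/-! ### Diagonalization over a PID, nullity of substituted matrices, and the lower bound. -/

section Nullity

open Module Polynomial

/-- As `P` is injective, its range has full rank and a basis `a i • b i` adapted to a basis `b` of
the whole module. Pulling it back through `P` gives the second change of basis. Divisibility among
the `a i` plays no role here. -/
theorem exists_smith_form {ι : Type*} [Fintype ι] [DecidableEq ι] {R : Type*} [CommRing R]
    [IsDomain R] [IsPrincipalIdealRing R] (P : Matrix ι ι R) (hP : P.det ≠ 0) :
    ∃ (E F : Matrix ι ι R) (a : ι → R), IsUnit E.det ∧ IsUnit F.det ∧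
      P = E * Matrix.diagonal a * F := by
  have hinj : Function.Injective (Matrix.toLin' P) := by
    rw [← LinearMap.ker_eq_bot, LinearMap.ker_eq_bot']
    intro v hv
    exact Matrix.eq_zero_of_mulVec_eq_zero hP (by simpa using hv)
  let e := LinearEquiv.ofInjective (Matrix.toLin' P) hinj
  obtain ⟨b, a, c, h⟩ := Submodule.exists_smith_normal_form_of_rank_eq
    (N := LinearMap.range (Matrix.toLin' P)) (Pi.basisFun R ι) e.finrank_eq.symm
  let c' := c.map e.symm
  have hc : ∀ i, Matrix.toLin' P (c' i) = a i • b i := by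
    intro i
    rw [← h i]
    have : e (c' i) = c i := by simp [c']
    rw [← this]
    rfl
  have hD : LinearMap.toMatrix c' b (Matrix.toLin' P) = Matrix.diagonal a := by
    ext i j
    rw [LinearMap.toMatrix_apply, hc, map_smul, Basis.repr_self]
    by_cases hij : i = j
    · subst hij; simp
    · simp [hij]
  refine ⟨(Pi.basisFun R ι).toMatrix b, c'.toMatrix (Pi.basisFun R ι), a, ?_, ?_, ?_⟩
  · rw [← Basis.det_apply]
    exact Basis.isUnit_det _ b
  · rw [← Basis.det_apply]
    exact Basis.isUnit_det _ _
  · rw [← hD, basis_toMatrix_mul_linearMap_toMatrix_mul_basis_toMatrix,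
      LinearMap.toMatrix_eq_toMatrix', LinearMap.toMatrix'_toLin']

theorem finrank_ker_comp_le {K V : Type*} [Field K] [AddCommGroup V] [Module K V]
    [FiniteDimensional K V] (f g : V →ₗ[K] V) :
    finrank K (LinearMap.ker (f ∘ₗ g)) ≤
      finrank K (LinearMap.ker f) + finrank K (LinearMap.ker g) := by
  have h := LinearMap.finrank_range_add_finrank_ker (g.domRestrict (LinearMap.ker (f ∘ₗ g)))
  have h1 : LinearMap.range (g.domRestrict (LinearMap.ker (f ∘ₗ g))) ≤ LinearMap.ker f := by
    rintro _ ⟨x, rfl⟩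
    exact x.2
  have h2 : finrank K (LinearMap.ker (g.domRestrict (LinearMap.ker (f ∘ₗ g)))) ≤
      finrank K (LinearMap.ker g) := by
    refine LinearMap.finrank_le_finrank_of_injective
      (f := ((Submodule.subtype _ ∘ₗ Submodule.subtype _).codRestrict _ fun x => x.2)) ?_
    intro x y hxy
    have := congrArg Subtype.val hxy
    exact Subtype.ext (Subtype.ext this)
  have h3 := Submodule.finrank_mono h1
  omega

theorem finrank_ker_prod_le {K V ι : Type*} [Field K] [AddCommGroup V] [Module K V]
    [FiniteDimensional K V] (f : V →ₗ[K] V) (s : Finset ι) (a : ι → K[X]) :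
    finrank K (LinearMap.ker (aeval f (∏ i ∈ s, a i))) ≤
      ∑ i ∈ s, finrank K (LinearMap.ker (aeval f (a i))) := by
  classical
  induction s using Finset.induction_on with
  | empty =>
    rw [Finset.prod_empty, map_one, Module.End.one_eq_id, LinearMap.ker_id, finrank_bot]
    exact Nat.zero_le _
  | insert i s hi ih =>
    rw [Finset.prod_insert hi, Finset.sum_insert hi, map_mul, Module.End.mul_eq_comp]
    exact (finrank_ker_comp_le _ _).trans (Nat.add_le_add_left ih _)

/-- Substitution of a matrix for the variable of a polynomial matrix, as a ring homomorphism; the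
entries become blocks. -/
noncomputable def substHom {n r : ℕ} (D : Matrix (Fin r) (Fin r) ℂ) :
    Matrix (Fin n) (Fin n) ℂ[X] →+* Matrix (Fin r × Fin n) (Fin r × Fin n) ℂ :=
  (Matrix.reindexAlgEquiv ℂ ℂ (Equiv.prodComm (Fin n) (Fin r))).toRingEquiv.toRingHom.comp
    ((Matrix.compRingEquiv (Fin n) (Fin r) ℂ).toRingHom.comp
      (aeval D : ℂ[X] →ₐ[ℂ] _).toRingHom.mapMatrix)

theorem substHom_apply {n r : ℕ} (D : Matrix (Fin r) (Fin r) ℂ) (P : Matrix (Fin n) (Fin n) ℂ[X])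
    (x y : Fin r × Fin n) : substHom D P x y = aeval D (P x.2 y.2) x.1 y.1 := rfl

/-- Substitution is a ring homomorphism, so the unimodular factors stay invertible and the diagonal
factor becomes block diagonal with blocks `a i (D)`. The product of these blocks is zero, so their
kernel dimensions add up to at least `r`. -/
theorem rank_substHom_add_le {n r : ℕ} (D : Matrix (Fin r) (Fin r) ℂ)
    (P : Matrix (Fin n) (Fin n) ℂ[X]) (hP : P.det ≠ 0) (hD : aeval D P.det = 0) :
    (substHom D P).rank + r ≤ Fintype.card (Fin r × Fin n) := by
  obtain ⟨E, F, a, hE, hF, rfl⟩ := exists_smith_form P hP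
  have hunit : ∀ G : Matrix (Fin n) (Fin n) ℂ[X], IsUnit G.det →
      IsUnit (substHom (r := r) D G).det := fun G hG =>
    (Matrix.isUnit_iff_isUnit_det _).1 (((Matrix.isUnit_iff_isUnit_det G).2 hG).map _)
  rw [map_mul, map_mul, Matrix.rank_mul_eq_left_of_isUnit_det _ _ (hunit F hF),
    Matrix.rank_mul_eq_right_of_isUnit_det _ _ (hunit E hE)]
  have hprod : aeval D (∏ i, a i) = 0 := by
    rw [Matrix.det_mul, Matrix.det_mul, Matrix.det_diagonal] at hD
    have h1 : E.det * (∏ i, a i) * F.det = (E.det * F.det) * ∏ i, a i := by ring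
    rw [h1, map_mul] at hD
    exact ((hE.mul hF).map (aeval D)).mul_right_eq_zero.1 hD
  have hlin : ∀ p : ℂ[X], aeval (Matrix.toLin' D) p = Matrix.toLin' (aeval D p) := fun p =>
    aeval_algHom_apply (Matrix.toLinAlgEquiv' : _ ≃ₐ[ℂ] _) D p
  have h1 : r ≤ ∑ i, finrank ℂ (LinearMap.ker (Matrix.toLin' (aeval D (a i)))) := by
    have := finrank_ker_prod_le (Matrix.toLin' D) Finset.univ a
    rw [hlin, hprod, map_zero, LinearMap.ker_zero, finrank_top, finrank_fin_fun] at this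
    exact this.trans (le_of_eq (Finset.sum_congr rfl fun i _ => by rw [hlin]))
  have h2 : ∑ i, finrank ℂ (LinearMap.ker (Matrix.toLin' (aeval D (a i)))) ≤
      finrank ℂ (LinearMap.ker (substHom D (Matrix.diagonal a)).mulVecLin) := by
    rw [← finrank_pi_fintype]
    let L : (∀ i, LinearMap.ker (Matrix.toLin' (aeval D (a i)))) →ₗ[ℂ] (Fin r × Fin n → ℂ) :=
      { toFun := fun x p => (x p.2 : Fin r → ℂ) p.1
        map_add' := fun x y => rfl
        map_smul' := fun c x => rfl }
    refine LinearMap.finrank_le_finrank_of_injective (f := L.codRestrict _ fun x => ?_) ?_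
    · rw [LinearMap.mem_ker]
      ext ⟨c, i⟩
      have hx : Matrix.toLin' (aeval D (a i)) (x i) = 0 := (x i).2
      have hx' := congrFun hx c
      rw [Matrix.toLin'_apply, Matrix.mulVec, dotProduct] at hx'
      rw [Matrix.mulVecLin_apply, Matrix.mulVec, dotProduct, Fintype.sum_prod_type,
        Pi.zero_apply, ← Pi.zero_apply (M := fun _ => ℂ) c, ← hx']
      refine Finset.sum_congr rfl fun d _ => ?_
      rw [Finset.sum_eq_single i]
      · simp [substHom_apply, L]
      · intro j _ hj
        simp [substHom_apply, Matrix.diagonal_apply_ne _ (Ne.symm hj)]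
      · simp
    · intro x y hxy
      have h := congrArg Subtype.val hxy
      funext i
      exact Subtype.ext (funext fun c => congrFun h (c, i))
  have h3 := LinearMap.finrank_range_add_finrank_ker (substHom D (Matrix.diagonal a)).mulVecLin
  rw [finrank_fintype_fun_eq_card] at h3
  rw [Matrix.rank]
  omega

theorem substHom_matPoly {n m r : ℕ} (A : Fin (m + 1) → Matrix (Fin n) (Fin n) ℂ)
    (μ : Fin r → ℂ) (Γ : StrictUpper r → ℂ) :
    substHom (Cmat μ Γ)ᵀ (matPoly A) = Qmat A μ Γ := by
  ext ⟨c, i⟩ ⟨d, j⟩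
  simp only [substHom_apply, matPoly, Qmat, Matrix.sum_apply, map_sum, Matrix.smul_apply,
    Matrix.map_apply, smul_eq_mul, map_mul, map_pow, aeval_X, aeval_C, Matrix.kroneckerMap_apply,
    Matrix.transpose_pow]
  refine Finset.sum_congr rfl fun k _ => ?_
  rw [Matrix.algebraMap_eq_diagonal, Matrix.mul_diagonal]
  rfl

theorem substHom_map_C {n r : ℕ} (D : Matrix (Fin r) (Fin r) ℂ) (Δ : Matrix (Fin n) (Fin n) ℂ) :
    substHom D (Δ.map C) = 1 ⊗ₖ Δ := by
  ext ⟨c, i⟩ ⟨d, j⟩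
  simp only [substHom_apply, Matrix.map_apply, aeval_C, Matrix.kroneckerMap_apply,
    Matrix.algebraMap_matrix_apply, Matrix.one_apply]
  simp

theorem charpoly_Cmat {r : ℕ} (μ : Fin r → ℂ) (Γ : StrictUpper r → ℂ) :
    (Cmat μ Γ).charpoly = ∏ i, (X - C (μ i)) := by
  rw [Matrix.charpoly_of_isUpperTriangular]
  · simp [Cmat]
  · intro i j hij
    have hij' : j < i := hij
    simp [Cmat, hij'.ne', hij'.not_gt]

/-- The Euclidean operator norm bounds a perturbation that makes the kernel `k`-dimensional from
below by the `k`-th smallest singular value. -/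
theorem sigmaNeg_le_of_rank_add_le {ι : Type} [Fintype ι] [DecidableEq ι] (B Δ : Matrix ι ι ℂ)
    {k : ℕ} {s : ℝ} (hs : 0 ≤ s) (h : (B + Δ).rank + k ≤ Fintype.card ι)
    (hΔ : ∀ x, ‖Matrix.toEuclideanLin Δ x‖ ≤ s * ‖x‖) : sigmaNeg k B ≤ s := by
  have h1 := LinearMap.finrank_range_add_finrank_ker (Matrix.toEuclideanLin (B + Δ))
  have h2 : (B + Δ).rank = finrank ℂ (LinearMap.range (Matrix.toEuclideanLin (B + Δ))) := by
    rw [Matrix.toEuclideanLin_eq_toLin_orthonormal]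
    exact Matrix.rank_eq_finrank_range_toLin _ _ _
  rw [finrank_euclideanSpace] at h1
  refine singularValues_le_of_subspace _ hs (LinearMap.ker (Matrix.toEuclideanLin (B + Δ)))
    (by rw [finrank_euclideanSpace]; omega) fun x hx => ?_
  have h3 : Matrix.toEuclideanLin B x = - Matrix.toEuclideanLin Δ x := by
    rw [LinearMap.mem_ker, map_add, LinearMap.add_apply] at hx
    exact eq_neg_of_add_eq_zero_left hx
  rw [h3, norm_neg]
  exact hΔ x

theorem norm2_nonneg {n : ℕ} (Δ : Matrix (Fin n) (Fin n) ℂ) : 0 ≤ norm2 Δ := norm_nonneg _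

theorem sum_norm_sq_mulVec_le {n : ℕ} (Δ : Matrix (Fin n) (Fin n) ℂ) (x : Fin n → ℂ) :
    ∑ i, ‖(Δ *ᵥ x) i‖ ^ 2 ≤ norm2 Δ ^ 2 * ∑ i, ‖x i‖ ^ 2 := by
  have h := (Matrix.toEuclideanCLM (n := Fin n) (𝕜 := ℂ) Δ).le_opNorm (WithLp.toLp 2 x)
  have h2 := pow_le_pow_left₀ (norm_nonneg _) h 2
  rw [mul_pow, EuclideanSpace.norm_sq_eq, EuclideanSpace.norm_sq_eq] at h2
  exact h2

theorem norm_one_kronecker_le {n r : ℕ} (Δ : Matrix (Fin n) (Fin n) ℂ)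
    (x : EuclideanSpace ℂ (Fin r × Fin n)) :
    ‖Matrix.toEuclideanLin ((1 : Matrix (Fin r) (Fin r) ℂ) ⊗ₖ Δ) x‖ ≤ norm2 Δ * ‖x‖ := by
  refine le_of_sq_le_sq ?_ (mul_nonneg (norm2_nonneg Δ) (norm_nonneg x))
  rw [mul_pow, EuclideanSpace.norm_sq_eq, EuclideanSpace.norm_sq_eq, Fintype.sum_prod_type,
    Fintype.sum_prod_type, Finset.mul_sum]
  refine Finset.sum_le_sum fun c _ => ?_
  refine le_trans (le_of_eq ?_) (sum_norm_sq_mulVec_le Δ fun i => x (c, i))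
  refine Finset.sum_congr rfl fun i _ => ?_
  congr 2
  change (((1 : Matrix (Fin r) (Fin r) ℂ) ⊗ₖ Δ) *ᵥ x.ofLp) (c, i) = _
  rw [Matrix.mulVec, Matrix.mulVec, dotProduct, dotProduct, Fintype.sum_prod_type,
    Finset.sum_eq_single c]
  · simp
  · intro d _ hd
    simp [Matrix.one_apply_ne (Ne.symm hd)]
  · simp

theorem exists_prod_dvd_of_feasible {S : Finset ℂ} {r : ℕ} (p : ℂ[X])
    (h : r ≤ ∑ z ∈ S, p.rootMultiplicity z) :
    ∃ ν : Fin r → ℂ, (∀ i, ν i ∈ S) ∧ (∏ i, (X - C (ν i))) ∣ p := by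
  have hcard : r ≤ (p.roots.filter (· ∈ S)).card := by
    refine h.trans (le_of_eq ?_)
    rw [← Multiset.sum_count_eq_card (s := S)]
    · refine Finset.sum_congr rfl fun z hz => ?_
      rw [Multiset.count_filter_of_pos hz, count_roots]
    · intro a ha
      exact (Multiset.mem_filter.1 ha).2
  obtain ⟨t, ht⟩ := Multiset.card_pos_iff_exists_mem.1 ((Multiset.card_powersetCard r _).symm ▸
    Nat.choose_pos hcard)
  obtain ⟨hle, htc⟩ := Multiset.mem_powersetCard.1 ht
  have hlen : t.toList.length = r := by rw [Multiset.length_toList, htc]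
  subst hlen
  refine ⟨t.toList.get, fun i => ?_, ?_⟩
  · exact (Multiset.mem_filter.1
      (Multiset.mem_of_le hle (Multiset.mem_toList.1 (t.toList.get_mem i)))).2
  · have h1 : (∏ i, (X - C (t.toList.get i))) = (t.map fun a => X - C a).prod := by
      rw [← List.prod_ofFn]
      change (List.ofFn ((fun a => X - C a) ∘ t.toList.get)).prod = _
      rw [← List.map_ofFn, List.ofFn_get, ← Multiset.prod_coe, ← Multiset.map_coe,
        Multiset.coe_toList]
    rw [h1]
    exact (Multiset.prod_dvd_prod_of_le (Multiset.map_le_map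
      (hle.trans (Multiset.filter_le _ _)))).trans (prod_multiset_X_sub_C_dvd p)

/-- A feasible perturbation bounds `κ_r` at some point of `S^r`. -/
theorem exists_sigmaNeg_le_of_feasible {n m r : ℕ} (hr : 0 < r)
    (A : Fin (m + 1) → Matrix (Fin n) (Fin n) ℂ) (S : Finset ℂ) (Δ : Matrix (Fin n) (Fin n) ℂ)
    (hΔ : Feasible A S r Δ) :
    ∃ ν : Fin r → ℂ, (∀ i, ν i ∈ S) ∧ ∀ Γ, sigmaNeg r (Qmat A ν Γ) ≤ norm2 Δ := by
  obtain ⟨ν, hν, hdvd⟩ := exists_prod_dvd_of_feasible _ hΔ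
  refine ⟨ν, hν, fun Γ => ?_⟩
  -- The zero polynomial has `rootMultiplicity` 0 by convention, so a vanishing determinant is not
  -- feasible when `r > 0`.
  have hdet : (matPoly A + Δ.map C).det ≠ 0 := by
    intro h0
    unfold Feasible algMult at hΔ
    simp only [h0, rootMultiplicity_zero, Finset.sum_const_zero] at hΔ
    omega
  refine sigmaNeg_le_of_rank_add_le _ (1 ⊗ₖ Δ) (norm2_nonneg Δ) ?_ (norm_one_kronecker_le Δ)
  rw [← substHom_matPoly, ← substHom_map_C (Cmat ν Γ)ᵀ, ← map_add]
  refine rank_substHom_add_le _ _ hdet ?_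
  obtain ⟨q, hq⟩ := hdvd
  rw [hq, ← charpoly_Cmat ν Γ, map_mul, ← Matrix.charpoly_transpose, Matrix.aeval_self_charpoly,
    zero_mul]

end Nullity

/-! ### Invariant pairs and feasibility. -/

section InvariantPair

open Polynomial

theorem isUnit_det_of_rank_eq {n : ℕ} {B : Matrix (Fin n) (Fin n) ℂ} (h : B.rank = n) :
    IsUnit B.det := by
  rw [← Matrix.isUnit_iff_isUnit_det, ← Matrix.linearIndependent_cols_iff_isUnit,
    linearIndependent_iff_card_eq_finrank_span, Set.finrank, ← Matrix.rank_eq_finrank_span_cols, h,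
    Fintype.card_fin]

/-- The reversed polynomial `t^m (P(1/t) + Δ)` extends continuously to `t = 0` with value `A_m`; `m
> 0` is what removes `Δ` there. An identically zero determinant would force `det A_m = 0`. -/
theorem det_matPoly_add_ne_zero {n m : ℕ} (hm : 0 < m)
    (A : Fin (m + 1) → Matrix (Fin n) (Fin n) ℂ) (hA : (A (Fin.last m)).rank = n)
    (Δ : Matrix (Fin n) (Fin n) ℂ) : (matPoly A + Δ.map C).det ≠ 0 := by
  intro h0
  have hdet : (A (Fin.last m)).det ≠ 0 := (isUnit_det_of_rank_eq hA).ne_zero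
  let g : ℂ → ℂ := fun t => (∑ j : Fin (m + 1), t ^ (m - (j : ℕ)) • A j + t ^ m • Δ).det
  have hg : Continuous g := by
    refine Continuous.matrix_det ?_
    fun_prop
  have hz : Set.EqOn g (fun _ => 0) {0}ᶜ := by
    intro t ht
    have ht' : t ≠ 0 := ht
    have h1 : ((matPoly A + Δ.map C).map (evalRingHom t⁻¹)).det = 0 := by
      rw [← RingHom.mapMatrix_apply, ← RingHom.map_det, h0, map_zero]
    have h2 : (matPoly A + Δ.map C).map (evalRingHom t⁻¹) =
        ∑ j : Fin (m + 1), t⁻¹ ^ (j : ℕ) • A j + Δ := by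
      ext a b
      simp only [matPoly, Matrix.map_apply, Matrix.add_apply, Matrix.sum_apply, Matrix.smul_apply,
        smul_eq_mul, coe_evalRingHom, eval_add, eval_finsetSum, eval_mul, eval_pow, eval_X, eval_C]
    have h3 : ∑ j : Fin (m + 1), t ^ (m - (j : ℕ)) • A j + t ^ m • Δ =
        t ^ m • (∑ j : Fin (m + 1), t⁻¹ ^ (j : ℕ) • A j + Δ) := by
      rw [smul_add, Finset.smul_sum]
      congr 1
      refine Finset.sum_congr rfl fun j _ => ?_
      rw [smul_smul, pow_sub₀ _ ht' (Nat.lt_succ_iff.1 j.2), inv_pow]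
    change (∑ j : Fin (m + 1), t ^ (m - (j : ℕ)) • A j + t ^ m • Δ).det = 0
    rw [h3, Matrix.det_smul, ← h2, h1, mul_zero]
  have hall := Continuous.ext_on (dense_compl_singleton (0 : ℂ)) hg continuous_const hz
  have h00 := congrFun hall 0
  have hg0 : g 0 = (A (Fin.last m)).det := by
    change (∑ j : Fin (m + 1), (0 : ℂ) ^ (m - (j : ℕ)) • A j + (0 : ℂ) ^ m • Δ).det = _
    rw [zero_pow hm.ne', zero_smul, add_zero, Finset.sum_eq_single (Fin.last m)]
    · simp
    · intro j _ hj
      have : (j : ℕ) < m := by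
        have h1 := j.2
        have h2 : (j : ℕ) ≠ m := fun h => hj (Fin.ext h)
        omega
      rw [zero_pow (by omega), zero_smul]
    · simp
  exact hdet (hg0.symm.trans h00)

theorem pinv_mul_self {n r : ℕ} (V : Matrix (Fin n) (Fin r) ℂ) (hV : V.rank = r) :
    pinv V * V = 1 := by
  have hinj : Function.Injective V.mulVec := by
    rw [← Matrix.coe_mulVecLin, ← LinearMap.ker_eq_bot, ← Submodule.finrank_eq_zero]
    have := LinearMap.finrank_range_add_finrank_ker V.mulVecLin
    rw [← Matrix.rank, hV, Module.finrank_fin_fun] at this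
    omega
  have h := (pinv_penrose V hV).1
  rw [Matrix.mul_assoc] at h
  refine Matrix.ext_of_mulVec_single fun i => hinj ?_
  rw [Matrix.mulVec_mulVec, h, Matrix.one_mulVec]

/-- An invariant pair `(V, K)` with `V` of full column rank: the characteristic polynomial of `K`
divides the determinant. -/
theorem charpoly_dvd_det_of_invariantPair {n m r : ℕ}
    (A : Fin (m + 1) → Matrix (Fin n) (Fin n) ℂ) (Δ : Matrix (Fin n) (Fin n) ℂ)
    (V : Matrix (Fin n) (Fin r) ℂ) (K : Matrix (Fin r) (Fin r) ℂ) (hV : V.rank = r)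
    (h : ∑ j : Fin (m + 1), A j * V * K ^ (j : ℕ) + Δ * V = 0) :
    K.charpoly ∣ (matPoly A + Δ.map C).det := by
  set P := matPoly A + Δ.map C with hP
  set Vp : Matrix (Fin n) (Fin r) ℂ[X] := V.map C with hVp
  set W : Matrix (Fin r) (Fin n) ℂ[X] := (pinv V).map C with hW
  have hWV : W * Vp = 1 := by
    rw [hW, hVp, ← Matrix.map_mul, pinv_mul_self V hV, Matrix.map_one _ C.map_zero C.map_one]
  let Xm : Matrix (Fin r) (Fin r) ℂ[X] := Matrix.scalar (Fin r) X
  let Kp : Matrix (Fin r) (Fin r) ℂ[X] := K.map C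
  have hch : K.charmatrix = Xm - Kp := rfl
  have hcomm : Commute Xm Kp := Matrix.scalar_commute _ (fun _ => Commute.all _ _) _
  -- Modulo right multiples of `X - K`, powers of `X` may be replaced by powers of `K`. This turns
  -- `P V` into `∑ A_j V K^j + Δ V = 0`.
  have hfac : ∃ G : Matrix (Fin n) (Fin r) ℂ[X], P * Vp = G * K.charmatrix := by
    refine ⟨∑ j : Fin (m + 1), (A j * V).map C *
      ∑ i ∈ Finset.range j, Xm ^ i * Kp ^ ((j : ℕ) - 1 - i), ?_⟩
    rw [hch, Matrix.sum_mul]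
    have e0 : ∀ (M : Matrix (Fin n) (Fin r) ℂ[X]) (j : ℕ),
        M * (∑ i ∈ Finset.range j, Xm ^ i * Kp ^ (j - 1 - i)) * (Xm - Kp) =
          M * Xm ^ j - M * Kp ^ j := fun M j => by
      rw [Matrix.mul_assoc, hcomm.geom_sum₂_mul, Matrix.mul_sub]
    simp only [e0, Finset.sum_sub_distrib]
    have e1 : ∑ j : Fin (m + 1), (A j * V).map C * Kp ^ (j : ℕ) = -((Δ * V).map C) := by
      have h' := congrArg (fun M : Matrix (Fin n) (Fin r) ℂ => M.map C) (eq_neg_of_add_eq_zero_left h)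
      have h1 : (-(Δ * V)).map (C : ℂ → ℂ[X]) = -((Δ * V).map C) := by
        exact Matrix.ext fun a b => map_neg C _
      refine Eq.trans ?_ (h'.trans h1)
      refine Eq.trans ?_ (map_sum (C : ℂ →+* ℂ[X]).toAddMonoidHom.mapMatrix _ _).symm
      refine Finset.sum_congr rfl fun j _ => ?_
      change _ = (A j * V * K ^ (j : ℕ)).map C
      rw [Matrix.map_mul (L := A j * V)]
      exact congrArg _ (map_pow (C : ℂ →+* ℂ[X]).mapMatrix K j).symm
    have e2 : ∑ j : Fin (m + 1), (A j * V).map C * Xm ^ (j : ℕ) = matPoly A * Vp := by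
      rw [matPoly, Matrix.sum_mul]
      refine Finset.sum_congr rfl fun j _ => ?_
      rw [← map_pow, Matrix.scalar_apply, ← Matrix.smul_eq_mul_diagonal, Matrix.map_mul,
        Matrix.smul_mul]
    rw [e1, e2, sub_neg_eq_add, hP, Matrix.add_mul, Matrix.map_mul]
  obtain ⟨G, hG⟩ := hfac
  -- `H` acts as `X - K` along the columns of `V` and as the identity on the kernel of `W`. Its
  -- determinant is therefore `K.charpoly`, and `P` is a left multiple of it.
  let H : Matrix (Fin n) (Fin n) ℂ[X] := 1 + Vp * ((K.charmatrix - 1) * W)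
  have hH : H.det = K.charpoly := by
    rw [Matrix.det_one_add_mul_comm, Matrix.mul_assoc, hWV, Matrix.mul_one, add_sub_cancel,
      Matrix.charpoly]
  have hfact : P = (G * W + P * (1 - Vp * W)) * H := by
    have e1 : W * H = K.charmatrix * W := by
      rw [Matrix.mul_add, Matrix.mul_one, ← Matrix.mul_assoc, hWV, Matrix.one_mul, Matrix.sub_mul,
        Matrix.one_mul, add_sub_cancel]
    have e2 : (1 - Vp * W) * H = 1 - Vp * W := by
      rw [Matrix.sub_mul, Matrix.one_mul, Matrix.mul_assoc, e1]
      simp only [H, Matrix.sub_mul, Matrix.one_mul, Matrix.mul_sub]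
      abel
    rw [Matrix.add_mul, Matrix.mul_assoc, e1, Matrix.mul_assoc, e2, ← Matrix.mul_assoc, ← hG,
      Matrix.mul_sub, Matrix.mul_one, Matrix.mul_assoc]
    abel
  rw [hfact, Matrix.det_mul, hH]
  exact dvd_mul_left _ _

theorem feasible_of_charpoly_dvd {n m r : ℕ} (A : Fin (m + 1) → Matrix (Fin n) (Fin n) ℂ)
    (S : Finset ℂ) (Δ : Matrix (Fin n) (Fin n) ℂ) (hdet : (matPoly A + Δ.map C).det ≠ 0)
    (μ : Fin r → ℂ) (hμ : ∀ i, μ i ∈ S) (h : (∏ i, (X - C (μ i))) ∣ (matPoly A + Δ.map C).det) :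
    Feasible A S r Δ := by
  have h1 : (Multiset.map μ Finset.univ.val) ≤ (matPoly A + Δ.map C).det.roots := by
    have := roots.le_of_dvd hdet h
    have h2 : (∏ i, (X - C (μ i))) =
        ((Multiset.map μ Finset.univ.val).map fun a => X - C a).prod := by
      rw [Multiset.map_map]
      rfl
    rwa [h2, roots_multiset_prod_X_sub_C] at this
  have h2 : ∑ z ∈ S, (Multiset.map μ Finset.univ.val).count z = r := by
    rw [Multiset.sum_count_eq_card]
    · simp
    · intro a ha
      obtain ⟨i, _, rfl⟩ := Multiset.mem_map.1 ha
      exact hμ i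
  unfold Feasible algMult
  rw [← h2]
  refine Finset.sum_le_sum fun z _ => ?_
  rw [← count_roots]
  exact Multiset.count_le_of_le z h1

end InvariantPair

/-! ### The singular vector equations as matrix equations. -/

section Vec

theorem Qmat_mulVec_vec {n m r : ℕ} (A : Fin (m + 1) → Matrix (Fin n) (Fin n) ℂ) (μ : Fin r → ℂ)
    (Γ : StrictUpper r → ℂ) (V : Matrix (Fin n) (Fin r) ℂ) :
    Qmat A μ Γ *ᵥ V.vec = (∑ j : Fin (m + 1), A j * V * Cmat μ Γ ^ (j : ℕ)).vec := by
  rw [Qmat, Matrix.sum_mulVec, Matrix.vec_sum]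
  refine Finset.sum_congr rfl fun j _ => ?_
  rw [Matrix.kronecker_mulVec_vec, Matrix.transpose_transpose]

theorem star_vec_vecMul_Qmat {n m r : ℕ} (A : Fin (m + 1) → Matrix (Fin n) (Fin n) ℂ)
    (μ : Fin r → ℂ) (Γ : StrictUpper r → ℂ) (U : Matrix (Fin n) (Fin r) ℂ) :
    star U.vec ᵥ* Qmat A μ Γ = (∑ j : Fin (m + 1), Cmat μ Γ ^ (j : ℕ) * Uᴴ * A j)ᵀ.vec := by
  rw [Qmat, Matrix.vecMul_sum, Matrix.transpose_sum, Matrix.vec_sum]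
  refine Finset.sum_congr rfl fun j _ => ?_
  rw [Matrix.star_vec, Matrix.vec_vecMul_kronecker, Matrix.transpose_mul, Matrix.transpose_mul,
    Matrix.mul_assoc]
  rfl

end Vec

/-! ### Noncommutative difference quotients of powers. -/

section Telescope

variable {R : Type*} [Ring R]

/-- `∑_{a+b=j-1} x^a e y^b`. -/
def telescope (x e y : R) : ℕ → R
  | 0 => 0
  | j + 1 => x * telescope x e y j + e * y ^ j

theorem telescope_sub (x y : R) (j : ℕ) : telescope x (x - y) y j = x ^ j - y ^ j := by
  induction j with
  | zero => simp [telescope]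
  | succ j ih => rw [telescope, ih, pow_succ', pow_succ']; noncomm_ring

theorem telescope_smul {k : Type*} [CommRing k] [Algebra k R] (c : k) (x e y : R) (j : ℕ) :
    telescope x (c • e) y j = c • telescope x e y j := by
  induction j with
  | zero => simp [telescope]
  | succ j ih => rw [telescope, ih, telescope, smul_add, mul_smul_comm, smul_mul_assoc]

theorem telescope_succ' (x e y : R) (j : ℕ) :
    telescope x e y (j + 1) = telescope x e y j * y + x ^ j * e := by
  induction j with
  | zero => simp [telescope]
  | succ j ih =>
    change x * telescope x e y (j + 1) + e * y ^ (j + 1) =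
      (x * telescope x e y j + e * y ^ j) * y + x ^ (j + 1) * e
    rw [ih, pow_succ' x, pow_succ y]
    noncomm_ring

/-- The telescope of length `j + 1` can be built by adding a factor on the left or on the right; the
two expressions are compared. -/
theorem telescope_commutator (x e : R) (j : ℕ) :
    telescope x e x j * x - x * telescope x e x j = e * x ^ j - x ^ j * e := by
  have h := telescope_succ' x e x j
  simp only [telescope] at h
  rw [sub_eq_sub_iff_add_eq_add, ← h]
  abel

theorem telescope_mul_right (x e y : R) (j : ℕ) :
    telescope x (e * y) y j = telescope x e y j * y := by
  induction j with
  | zero => simp [telescope]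
  | succ j ih =>
    rw [telescope, ih, telescope, add_mul, mul_assoc, mul_assoc, mul_assoc,
      (Commute.pow_self y j).eq]

/-- The derivative of the `j`-th power is self-adjoint for the trace pairing. This moves the
direction `e` outside and leaves a fixed matrix to test against it. -/
theorem trace_mul_telescope {ι : Type*} [Fintype ι] [DecidableEq ι] (x e f : Matrix ι ι ℂ) (j : ℕ) :
    (f * telescope x e x j).trace = (telescope x f x j * e).trace := by
  induction j generalizing f with
  | zero => simp [telescope]
  | succ j ih =>
    rw [telescope_succ' x f x j, telescope, mul_add, ← mul_assoc, Matrix.trace_add, ih, add_mul,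
      Matrix.trace_add, telescope_mul_right, ← mul_assoc f, Matrix.trace_mul_comm (f * e),
      mul_assoc (x ^ j)]

theorem continuous_telescope [TopologicalSpace R] [IsTopologicalRing R] (e y : R) (j : ℕ) :
    Continuous fun x => telescope x e y j := by
  induction j with
  | zero => exact continuous_const
  | succ j ih => exact (continuous_id.mul ih).add continuous_const

end Telescope

/-! ### Stationarity, equality of Gram matrices, and the norm of the perturbation. -/

section Optimality

open Filter Topology

theorem Cmat_upper {r : ℕ} (μ : Fin r → ℂ) (Γ : StrictUpper r → ℂ) {i j : Fin r} (h : j < i) :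
    Cmat μ Γ i j = 0 := by
  simp [Cmat, h.ne', h.not_gt]

theorem Cmat_add_single {r : ℕ} (μ : Fin r → ℂ) (Γ : StrictUpper r → ℂ) (p : StrictUpper r)
    (c : ℂ) : Cmat μ (Γ + Pi.single p c) = Cmat μ Γ + c • Matrix.single p.1.1 p.1.2 1 := by
  obtain ⟨⟨i, k⟩, hik⟩ := p
  have hik' : i < k := hik
  ext a b
  by_cases hab : a = b
  · subst hab
    have : ¬ (i = a ∧ k = a) := fun h => hik'.ne (h.1.trans h.2.symm)
    simp [Cmat, this]
  · by_cases hlt : a < b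
    · by_cases h : i = a ∧ k = b
      · obtain ⟨rfl, rfl⟩ := h
        simp [Cmat, hik', hik'.ne]
      · have h' : (⟨(a, b), hlt⟩ : StrictUpper r) ≠ ⟨(i, k), hik⟩ := by
          intro he
          have := congrArg Subtype.val he
          exact h ⟨(congrArg Prod.fst this).symm, (congrArg Prod.snd this).symm⟩
        simp [Cmat, hab, hlt, h]
    · have : ¬ (i = a ∧ k = b) := fun h => hlt (h.1 ▸ h.2 ▸ hik')
      simp [Cmat, hab, hlt, this]

/-- The difference quotient of `Q` in the direction of the matrix `E`. -/
noncomputable def Qdiff {n m r : ℕ} (A : Fin (m + 1) → Matrix (Fin n) (Fin n) ℂ)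
    (X E Y : Matrix (Fin r) (Fin r) ℂ) : Matrix (Fin r × Fin n) (Fin r × Fin n) ℂ :=
  ∑ j : Fin (m + 1), (telescope X E Y (j : ℕ))ᵀ ⊗ₖ A j

theorem Qmat_sub {n m r : ℕ} (A : Fin (m + 1) → Matrix (Fin n) (Fin n) ℂ)
    (μ : Fin r → ℂ) (Γ Γ' : StrictUpper r → ℂ) :
    Qmat A μ Γ' - Qmat A μ Γ =
      Qdiff A (Cmat μ Γ') (Cmat μ Γ' - Cmat μ Γ) (Cmat μ Γ) := by
  rw [Qmat, Qmat, Qdiff, ← Finset.sum_sub_distrib]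
  refine Finset.sum_congr rfl fun j _ => ?_
  rw [telescope_sub, Matrix.transpose_sub, sub_eq_iff_eq_add, ← Matrix.add_kronecker, sub_add_cancel]

theorem Qdiff_smul {n m r : ℕ} (A : Fin (m + 1) → Matrix (Fin n) (Fin n) ℂ)
    (X E Y : Matrix (Fin r) (Fin r) ℂ) (c : ℂ) : Qdiff A X (c • E) Y = c • Qdiff A X E Y := by
  rw [Qdiff, Qdiff, Finset.smul_sum]
  refine Finset.sum_congr rfl fun j _ => ?_
  rw [telescope_smul, Matrix.transpose_smul, Matrix.smul_kronecker]

theorem continuous_kronecker_right {l p n : ℕ} (B : Matrix (Fin n) (Fin n) ℂ) :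
    Continuous fun X : Matrix (Fin l) (Fin p) ℂ => X ⊗ₖ B :=
  continuous_matrix fun _ _ => (continuous_id.matrix_elem _ _).mul continuous_const

theorem continuous_Qdiff {n m r : ℕ} (A : Fin (m + 1) → Matrix (Fin n) (Fin n) ℂ)
    (E Y : Matrix (Fin r) (Fin r) ℂ) : Continuous fun X => Qdiff A X E Y :=
  continuous_finsetSum _ fun j _ => (continuous_kronecker_right (A j)).comp
    (continuous_telescope E Y j).matrix_transpose

theorem continuous_toEuclideanCLM {ι : Type} [Fintype ι] [DecidableEq ι] :
    Continuous fun B : Matrix ι ι ℂ => Matrix.toEuclideanCLM (n := ι) (𝕜 := ℂ) B :=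
  LinearMap.continuous_of_finiteDimensional
    (Matrix.toEuclideanCLM (n := ι) (𝕜 := ℂ)).toAlgEquiv.toLinearMap

theorem sigmaNeg_eq {ι : Type} [Fintype ι] [DecidableEq ι] (k : ℕ) (B : Matrix ι ι ℂ) :
    sigmaNeg k B = ((Matrix.toEuclideanCLM (n := ι) (𝕜 := ℂ) B : _ →L[ℂ] _) :
      EuclideanSpace ℂ ι →ₗ[ℂ] EuclideanSpace ℂ ι).singularValues (Fintype.card ι - k) := by
  rw [Matrix.coe_toEuclideanCLM_eq_toEuclideanLin]
  rfl

theorem gap_of_singValMult_eq_one {ι : Type} [Fintype ι] [DecidableEq ι] (B : Matrix ι ι ℂ)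
    {q : ℕ} (hq : q < Fintype.card ι) (h : singValMult B (singVal B q) = 1) :
    ∀ i < q, singVal B q < singVal B i := by
  intro i hi
  refine lt_of_le_of_ne ((Matrix.toEuclideanLin B).singularValues_antitone hi.le) fun he => ?_
  obtain ⟨a, ha⟩ := Set.ncard_eq_one.1 h
  have h1 : q ∈ {j : ℕ | j < Fintype.card ι ∧ singVal B j = singVal B q} := ⟨hq, rfl⟩
  have h2 : i ∈ {j : ℕ | j < Fintype.card ι ∧ singVal B j = singVal B q} := ⟨hi.trans hq, he.symm⟩
  rw [ha] at h1 h2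
  exact hi.ne (h2.trans h1.symm)

/-- Stationarity of a maximal simple singular value. -/
theorem inner_Qdiff_eq_zero {n m r : ℕ} (hr : 0 < r) (hn : 0 < n)
    (A : Fin (m + 1) → Matrix (Fin n) (Fin n) ℂ) (μ : Fin r → ℂ) (Γ : StrictUpper r → ℂ)
    (U V : Matrix (Fin n) (Fin r) ℂ)
    (hmax : ∀ Γ', sigmaNeg r (Qmat A μ Γ') ≤ sigmaNeg r (Qmat A μ Γ))
    (hpair : SingularPair (Qmat A μ Γ) (sigmaNeg r (Qmat A μ Γ)) U V)
    (hmult : singValMult (Qmat A μ Γ) (sigmaNeg r (Qmat A μ Γ)) = 1)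
    (hpos : 0 < sigmaNeg r (Qmat A μ Γ)) (p : StrictUpper r) :
    star U.vec ⬝ᵥ (Qdiff A (Cmat μ Γ) (Matrix.single p.1.1 p.1.2 1) (Cmat μ Γ) *ᵥ V.vec) = 0 := by
  set Q := Qmat A μ Γ with hQ
  set s := sigmaNeg r Q with hs
  set K := Cmat μ Γ with hK
  set E : Matrix (Fin r) (Fin r) ℂ := Matrix.single p.1.1 p.1.2 1 with hE
  obtain ⟨hU1, hV1, hQV, hQU⟩ := hpair
  set z := star U.vec ⬝ᵥ (Qdiff A K E K *ᵥ V.vec) with hz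
  let cl := fun B : Matrix (Fin r × Fin n) (Fin r × Fin n) ℂ =>
    Matrix.toEuclideanCLM (n := Fin r × Fin n) (𝕜 := ℂ) B
  have hq : Fintype.card (Fin r × Fin n) - r < Fintype.card (Fin r × Fin n) := by
    rw [Fintype.card_prod, Fintype.card_fin, Fintype.card_fin]
    have : 0 < r * n := Nat.mul_pos hr hn
    omega
  have hadj : ((cl Q : _ →L[ℂ] _) : EuclideanSpace ℂ (Fin r × Fin n) →ₗ[ℂ] _).adjoint
      (cl Q (WithLp.toLp 2 V.vec)) = ((s ^ 2 : ℝ) : ℂ) • WithLp.toLp 2 V.vec := by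
    have h1 : cl Q (WithLp.toLp 2 V.vec) = (s : ℂ) • WithLp.toLp 2 U.vec := by
      change WithLp.toLp 2 (Q *ᵥ V.vec) = _
      rw [hQV]; rfl
    have h2 : Qᴴ *ᵥ U.vec = (s : ℂ) • V.vec := by
      have := congrArg star hQU
      rw [Matrix.star_vecMul, star_star, star_smul, star_star] at this
      simpa using this
    rw [h1, map_smul, Matrix.coe_toEuclideanCLM_eq_toEuclideanLin,
      ← Matrix.toEuclideanLin_conjTranspose_eq_adjoint]
    change (s : ℂ) • WithLp.toLp 2 (Qᴴ *ᵥ U.vec) = _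
    rw [h2, WithLp.toLp_smul, smul_smul, pow_two, Complex.ofReal_mul]
  -- Moving the entry `p` of `Γ` by `t θ` changes `Q` by exactly `t θ` times a difference quotient
  -- that converges to `Qdiff A K E K`. The one-sided first order condition applies in every complex
  -- direction `θ`.
  have key : ∀ θ : ℂ, (θ * z).re ≤ 0 := by
    intro θ
    let t : ℕ → ℝ := fun j => 1 / ((j : ℝ) + 1)
    let X : ℕ → Matrix (Fin r) (Fin r) ℂ := fun j => K + (t j : ℂ) • θ • E
    have ht0 : Tendsto t atTop (𝓝 0) := tendsto_one_div_add_atTop_nhds_zero_nat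
    have htp : ∀ j, 0 < t j := fun j => Nat.one_div_pos_of_nat
    have hX : Tendsto X atTop (𝓝 K) := by
      have h1 : Tendsto (fun j => (t j : ℂ)) atTop (𝓝 ((0 : ℝ) : ℂ)) :=
        (Complex.continuous_ofReal.tendsto 0).comp ht0
      have h2 := tendsto_const_nhds (x := K).add (h1.smul_const (θ • E))
      rw [Complex.ofReal_zero, zero_smul, add_zero] at h2
      exact h2
    have hB : Tendsto (fun j => cl (θ • Qdiff A (X j) E K)) atTop (𝓝 (cl (θ • Qdiff A K E K))) :=
      (continuous_toEuclideanCLM.tendsto _).comp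
        ((((continuous_Qdiff A E K).tendsto K).comp hX).const_smul θ)
    have hstep : ∀ j, cl Q + (t j : ℂ) • cl (θ • Qdiff A (X j) E K) =
        cl (Qmat A μ (Γ + Pi.single p ((t j : ℂ) * θ))) := by
      intro j
      have h1 : Cmat μ (Γ + Pi.single p ((t j : ℂ) * θ)) = X j := by
        rw [Cmat_add_single, mul_smul]
      have h2 := Qmat_sub A μ Γ (Γ + Pi.single p ((t j : ℂ) * θ))
      rw [h1, ← hK, ← hQ, show X j - K = (t j : ℂ) • θ • E from add_sub_cancel_left _ _,
        Qdiff_smul, Qdiff_smul, sub_eq_iff_eq_add'] at h2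
      rw [h2]
      simp only [cl, map_add, map_smul]
    have h := re_inner_nonpos_of_singularValues_le (cl Q) (cl (θ • Qdiff A K E K))
      (k := Fintype.card (Fin r × Fin n) - r) (by rwa [finrank_euclideanSpace])
      (by
        intro i hi
        rw [Matrix.coe_toEuclideanCLM_eq_toEuclideanLin]
        exact gap_of_singValMult_eq_one Q hq hmult i hi)
      hV1 (by rw [← sigmaNeg_eq]; exact hadj) t htp ht0 _ hB
      (by
        intro j
        rw [hstep j, ← sigmaNeg_eq, ← sigmaNeg_eq]
        exact hmax _)
    have h1 : cl Q (WithLp.toLp 2 V.vec) = (s : ℂ) • WithLp.toLp 2 U.vec := by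
      change WithLp.toLp 2 (Q *ᵥ V.vec) = _
      rw [hQV]; rfl
    have h2 : inner ℂ (WithLp.toLp 2 U.vec) (cl (θ • Qdiff A K E K) (WithLp.toLp 2 V.vec)) =
        θ * z := by
      change inner ℂ (WithLp.toLp 2 U.vec) (WithLp.toLp 2 ((θ • Qdiff A K E K) *ᵥ V.vec)) = _
      rw [EuclideanSpace.inner_toLp_toLp, Matrix.smul_mulVec, smul_dotProduct, dotProduct_comm]
      rfl
    rw [h1, inner_smul_left, h2, Complex.conj_ofReal, Complex.re_ofReal_mul] at h
    exact nonpos_of_mul_nonpos_right h hpos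
  -- The direction `θ = conj z` turns the inequality into `|z|² ≤ 0`.
  have h := key (starRingEnd ℂ z)
  rw [← Complex.normSq_eq_conj_mul_self, Complex.ofReal_re] at h
  exact Complex.normSq_eq_zero.1 (le_antisymm h (Complex.normSq_nonneg z))

/-- Below the diagonal both products vanish; on the diagonal both reduce to a product of the same
two diagonal entries. -/
theorem commutator_apply_eq_zero {r : ℕ} {M K : Matrix (Fin r) (Fin r) ℂ}
    (hM : ∀ i j, j < i → M i j = 0) (hK : ∀ i j, j < i → K i j = 0) {i j : Fin r} (hij : j ≤ i) :
    (M * K - K * M) i j = 0 := by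
  rw [Matrix.sub_apply, Matrix.mul_apply, Matrix.mul_apply, sub_eq_zero]
  rcases hij.lt_or_eq with h | rfl
  · rw [Finset.sum_eq_zero, Finset.sum_eq_zero]
    · intro l _
      rcases lt_or_ge l i with h1 | h1
      · rw [hK _ _ h1, zero_mul]
      · rw [hM _ _ (h.trans_le h1), mul_zero]
    · intro l _
      rcases lt_or_ge l i with h1 | h1
      · rw [hM _ _ h1, zero_mul]
      · rw [hK _ _ (h.trans_le h1), mul_zero]
  · refine Finset.sum_congr rfl fun l _ => ?_
    rcases lt_trichotomy l j with h1 | rfl | h1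
    · rw [hM _ _ h1, hK _ _ h1]; simp
    · exact mul_comm _ _
    · rw [hK _ _ h1, hM _ _ h1]; simp

/-- At a maximizer with a simple positive singular value the Gram matrices of the two factors
agree. -/
theorem gram_eq {n m r : ℕ} (hr : 0 < r) (hn : 0 < n)
    (A : Fin (m + 1) → Matrix (Fin n) (Fin n) ℂ) (μ : Fin r → ℂ) (Γ : StrictUpper r → ℂ)
    (U V : Matrix (Fin n) (Fin r) ℂ)
    (hmax : ∀ Γ', sigmaNeg r (Qmat A μ Γ') ≤ sigmaNeg r (Qmat A μ Γ))
    (hpair : SingularPair (Qmat A μ Γ) (sigmaNeg r (Qmat A μ Γ)) U V)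
    (hmult : singValMult (Qmat A μ Γ) (sigmaNeg r (Qmat A μ Γ)) = 1)
    (hpos : 0 < sigmaNeg r (Qmat A μ Γ)) : Uᴴ * U = Vᴴ * V := by
  set s := sigmaNeg r (Qmat A μ Γ) with hs
  set K := Cmat μ Γ with hK
  let M := ∑ j : Fin (m + 1), telescope K (Uᴴ * A j * V) K (j : ℕ)
  -- The derivative of `Q` in the direction `E_{ik}`, paired with `U` and `V`, is `tr (M E_{ik}) = M
  -- k i`. Stationarity for all `i < k` kills the strictly lower part.
  have hMtri : ∀ i j, j < i → M i j = 0 := by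
    intro k i hik
    have h := inner_Qdiff_eq_zero hr hn A μ Γ U V hmax hpair hmult hpos ⟨(i, k), hik⟩
    have h1 : Qdiff A K (Matrix.single i k 1) K *ᵥ V.vec =
        (∑ j : Fin (m + 1), A j * V * telescope K (Matrix.single i k 1) K (j : ℕ)).vec := by
      rw [Qdiff, Matrix.sum_mulVec, Matrix.vec_sum]
      refine Finset.sum_congr rfl fun j _ => ?_
      rw [Matrix.kronecker_mulVec_vec, Matrix.transpose_transpose]
    have h2 : (M * Matrix.single i k 1).trace = 0 := by
      rw [← h]
      change _ = star U.vec ⬝ᵥ (Qdiff A K (Matrix.single i k 1) K *ᵥ V.vec)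
      rw [h1, Matrix.star_vec_dotProduct_vec, Matrix.mul_sum, Matrix.trace_sum, Finset.sum_mul,
        Matrix.trace_sum]
      refine Finset.sum_congr rfl fun j _ => ?_
      rw [← trace_mul_telescope]
      simp only [Matrix.mul_assoc]
    rw [Matrix.trace_mul_comm, Matrix.trace_single_mul] at h2
    simpa using h2
  -- The telescope commutator leaves `Uᴴ ∑ A_j V K^j - (∑ K^j Uᴴ A_j) V`, and the right and left
  -- singular vector equations evaluate the two sums.
  have hcomm : M * K - K * M = (s : ℂ) • (Uᴴ * U - Vᴴ * V) := by
    obtain ⟨-, -, hQV, hQU⟩ := hpair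
    rw [Qmat_mulVec_vec, ← Matrix.vec_smul, Matrix.vec_inj] at hQV
    have hQU' : ∑ j : Fin (m + 1), K ^ (j : ℕ) * Uᴴ * A j = (s : ℂ) • Vᴴ := by
      have h1 : star V.vec = (Vᴴᵀ).vec := rfl
      rw [star_vec_vecMul_Qmat, h1, ← Matrix.vec_smul, Matrix.vec_inj, ← Matrix.transpose_smul] at hQU
      exact Matrix.transpose_injective hQU
    have h1 : M * K - K * M =
        ∑ j : Fin (m + 1), (Uᴴ * A j * V * K ^ (j : ℕ) - K ^ (j : ℕ) * (Uᴴ * A j * V)) := by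
      rw [Finset.sum_mul, Finset.mul_sum, ← Finset.sum_sub_distrib]
      exact Finset.sum_congr rfl fun j _ => telescope_commutator _ _ _
    rw [h1, Finset.sum_sub_distrib, smul_sub, ← Matrix.mul_smul, ← hQV, ← Matrix.smul_mul, ← hQU',
      Matrix.mul_sum, Matrix.sum_mul]
    simp only [Matrix.mul_assoc]
    rfl
  have hlow : ∀ i j, j ≤ i → (Uᴴ * U - Vᴴ * V) i j = 0 := by
    intro i j hij
    have h := commutator_apply_eq_zero hMtri (fun _ _ => Cmat_upper μ Γ) hij
    rw [← hK, hcomm, Matrix.smul_apply, smul_eq_mul] at h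
    exact (mul_eq_zero.1 h).resolve_left (Complex.ofReal_ne_zero.2 hpos.ne')
  have hherm : (Uᴴ * U - Vᴴ * V)ᴴ = Uᴴ * U - Vᴴ * V := by
    simp [Matrix.conjTranspose_sub, Matrix.conjTranspose_mul]
  rw [← sub_eq_zero]
  ext i j
  rcases le_total j i with h | h
  · exact hlow i j h
  · rw [← hherm, Matrix.conjTranspose_apply, hlow j i h, star_zero, Matrix.zero_apply]

/-- Equal Gram matrices give `(U V⁺)ᴴ (U V⁺) = V V⁺`, an orthogonal projection. The C*-identity
bounds first its norm and then that of `U V⁺` by 1. -/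
theorem norm2_mul_pinv_le_one {n r : ℕ} (U V : Matrix (Fin n) (Fin r) ℂ) (hV : V.rank = r)
    (h : Uᴴ * U = Vᴴ * V) : norm2 (U * pinv V) ≤ 1 := by
  have hsq : ∀ B : Matrix (Fin n) (Fin n) ℂ, norm2 (Bᴴ * B) = norm2 B * norm2 B := by
    intro B
    rw [norm2, norm2, map_mul, ← Matrix.star_eq_conjTranspose, map_star,
      ContinuousLinearMap.star_eq_adjoint]
    exact ContinuousLinearMap.norm_adjoint_comp_self _
  have hp := pinv_penrose V hV
  have h1 : (V * pinv V)ᴴ * (V * pinv V) = V * pinv V := by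
    rw [hp.2.2.1, ← Matrix.mul_assoc, hp.1]
  have h2 : norm2 (V * pinv V) ≤ 1 := by
    have := hsq (V * pinv V)
    rw [h1] at this
    nlinarith [norm2_nonneg (V * pinv V)]
  have h3 : (U * pinv V)ᴴ * (U * pinv V) = (V * pinv V)ᴴ * (V * pinv V) := by
    rw [Matrix.conjTranspose_mul, Matrix.conjTranspose_mul, Matrix.mul_assoc, ← Matrix.mul_assoc Uᴴ,
      h, Matrix.mul_assoc, Matrix.mul_assoc]
  have h4 := hsq (U * pinv V)
  rw [h3, h1] at h4
  nlinarith [norm2_nonneg (U * pinv V)]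

end Optimality

/-! ### Coercivity of `σ_{-r}` in `Γ` and existence of a maximizer. -/

section Attainment

open Module Filter Topology

/-- The matrix with `n × n` blocks `F l p`. -/
def blockMat {n r : ℕ} (F : Fin r → Fin r → Matrix (Fin n) (Fin n) ℂ) :
    Matrix (Fin r × Fin n) (Fin r × Fin n) ℂ :=
  Matrix.of fun x y => F x.1 y.1 x.2 y.2

theorem blockMat_mulVec {n r : ℕ} (F : Fin r → Fin r → Matrix (Fin n) (Fin n) ℂ)
    (x : Fin r × Fin n → ℂ) (l : Fin r) (a : Fin n) :
    (blockMat F *ᵥ x) (l, a) = (∑ p, F l p *ᵥ fun b => x (p, b)) a := by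
  rw [Matrix.mulVec, dotProduct, Fintype.sum_prod_type, Finset.sum_apply]
  rfl

/-- The block of `Q` in block row `l` and block column `p`. -/
noncomputable def Qblock {n m r : ℕ} (A : Fin (m + 1) → Matrix (Fin n) (Fin n) ℂ)
    (K : Matrix (Fin r) (Fin r) ℂ) (l p : Fin r) : Matrix (Fin n) (Fin n) ℂ :=
  ∑ j : Fin (m + 1), (K ^ (j : ℕ)) p l • A j

theorem Qmat_eq_blockMat {n m r : ℕ} (A : Fin (m + 1) → Matrix (Fin n) (Fin n) ℂ) (μ : Fin r → ℂ)
    (Γ : StrictUpper r → ℂ) : Qmat A μ Γ = blockMat (Qblock A (Cmat μ Γ)) := by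
  ext ⟨l, a⟩ ⟨p, b⟩
  simp [Qmat, blockMat, Qblock, Matrix.sum_apply, Matrix.kroneckerMap_apply,
    -Matrix.transpose_pow]

theorem card_subtype_le_fst {n r : ℕ} (k : Fin r) :
    Fintype.card {p : Fin r × Fin n // k ≤ p.1} =
      Fintype.card {p : Fin r × Fin n // k < p.1} + n := by
  have e : {p : Fin r × Fin n // p.1 = k} ≃ Fin n :=
    { toFun := fun p => p.1.2
      invFun := fun a => ⟨(k, a), rfl⟩
      left_inv := by rintro ⟨⟨_, a⟩, rfl⟩; rfl
      right_inv := fun _ => rfl }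
  have h1 : Fintype.card {p : Fin r × Fin n // p.1 = k} = n := by
    rw [Fintype.card_congr e, Fintype.card_fin]
  have h2 := Fintype.card_subtype_or_disjoint (fun p : Fin r × Fin n => k < p.1) (fun p => p.1 = k)
    (by
      rw [Pi.disjoint_iff]
      intro p
      rw [Prop.disjoint_iff, not_and]
      exact fun h h' => h.ne' h')
  rw [h1] at h2
  rw [← h2]
  refine Fintype.card_congr (Equiv.subtypeEquivRight fun p => ?_)
  rw [le_iff_lt_or_eq, eq_comm]

theorem card_le_card_add_finrank_ker {V s t : Type*} [AddCommGroup V] [Module ℂ V]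
    [FiniteDimensional ℂ V] [Fintype s] [Fintype t] (f : V →ₗ[ℂ] V) (L : (s → ℂ) →ₗ[ℂ] V)
    (hL : Function.Injective L) (ρ : V →ₗ[ℂ] (t → ℂ)) (h : ∀ z, ρ (f (L z)) = 0 → f (L z) = 0) :
    Fintype.card s ≤ Fintype.card t + finrank ℂ (LinearMap.ker f) := by
  have h1 := LinearMap.finrank_range_add_finrank_ker (ρ ∘ₗ f ∘ₗ L)
  have h2 := (LinearMap.range (ρ ∘ₗ f ∘ₗ L)).finrank_le
  rw [finrank_fintype_fun_eq_card] at h1 h2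
  have h3 : finrank ℂ (LinearMap.ker (ρ ∘ₗ f ∘ₗ L)) ≤ finrank ℂ (LinearMap.ker f) := by
    refine LinearMap.finrank_le_finrank_of_injective
      (f := (L ∘ₗ Submodule.subtype _).codRestrict _ fun z => h z.1 z.2) ?_
    intro x y hxy
    exact Subtype.ext (hL (congrArg Subtype.val hxy))
  omega

/-- A matrix that is block lower triangular outside block column `k`, in which block column `k`, down
to block row `k`, is a multiple of block column `i < k`, has a kernel of dimension at least the block size. -/
theorem rank_blockMat_add_le {n r : ℕ} (F : Fin r → Fin r → Matrix (Fin n) (Fin n) ℂ)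
    {i k : Fin r} (hik : i < k) (N : Matrix (Fin n) (Fin n) ℂ)
    (htri : ∀ l p, l < p → p ≠ k → F l p = 0) (hN : ∀ l ≤ k, F l k = F l i * N) :
    (blockMat F).rank + n ≤ Fintype.card (Fin r × Fin n) := by
  classical
  -- Vectors with free blocks from `k` on, block `i` equal to `-N z_k`, and zero elsewhere. Block
  -- columns `i` and `k` then cancel in block rows up to `k`, so only the rows beyond `k` remain as
  -- equations: `n` fewer than the unknowns.
  let L : ({p : Fin r × Fin n // k ≤ p.1} → ℂ) →ₗ[ℂ] (Fin r × Fin n → ℂ) :=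
    { toFun := fun z p => (if h : k ≤ p.1 then z ⟨p, h⟩ else 0) -
        (if p.1 = i then (N *ᵥ fun b => z ⟨(k, b), le_rfl⟩) p.2 else 0)
      map_add' := by
        intro y z
        funext p
        have : (N *ᵥ fun b => y ⟨(k, b), le_rfl⟩ + z ⟨(k, b), le_rfl⟩) =
            (N *ᵥ fun b => y ⟨(k, b), le_rfl⟩) + N *ᵥ fun b => z ⟨(k, b), le_rfl⟩ :=
          N.mulVec_add _ _
        simp only [Pi.add_apply, this]
        split_ifs <;> ring
      map_smul' := by
        intro c z
        funext p
        have : (N *ᵥ fun b => c * z ⟨(k, b), le_rfl⟩) =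
            c • N *ᵥ fun b => z ⟨(k, b), le_rfl⟩ :=
          N.mulVec_smul c _
        simp only [Pi.smul_apply, smul_eq_mul, RingHom.id_apply, this]
        split_ifs <;> ring }
  have hLk : ∀ z (p : Fin r × Fin n) (h : k ≤ p.1), L z p = z ⟨p, h⟩ := by
    intro z p h
    change (if h : k ≤ p.1 then z ⟨p, h⟩ else 0) - _ = _
    rw [dif_pos h, if_neg (hik.trans_le h).ne', sub_zero]
  have hLi : ∀ z, (fun b => L z (i, b)) = -(N *ᵥ fun b => z ⟨(k, b), le_rfl⟩) := by
    intro z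
    funext b
    change (if h : k ≤ i then z ⟨(i, b), h⟩ else 0) - _ = _
    rw [dif_neg hik.not_ge, if_pos rfl, zero_sub, Pi.neg_apply]
  have hL0 : ∀ z p, p < k → p ≠ i → (fun b => L z (p, b)) = 0 := by
    intro z p hp hpi
    funext b
    change (if h : k ≤ p then z ⟨(p, b), h⟩ else 0) - _ = _
    rw [dif_neg hp.not_ge, if_neg hpi, sub_zero, Pi.zero_apply]
  have hLinj : Function.Injective L := by
    intro y z hyz
    funext p
    rw [← hLk y p.1 p.2, ← hLk z p.1 p.2, hyz]
  let ρ : (Fin r × Fin n → ℂ) →ₗ[ℂ] ({p : Fin r × Fin n // k < p.1} → ℂ) :=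
    LinearMap.funLeft ℂ ℂ Subtype.val
  have key := card_le_card_add_finrank_ker (blockMat F).mulVecLin L hLinj ρ (by
    intro z hz
    funext ⟨l, a⟩
    rcases lt_or_ge k l with hl | hl
    · exact congrFun hz ⟨(l, a), hl⟩
    · rw [Matrix.mulVecLin_apply, blockMat_mulVec, Finset.sum_eq_add i k hik.ne]
      · have hk : (fun b => L z (k, b)) = fun b => z ⟨(k, b), le_rfl⟩ :=
          funext fun b => hLk z (k, b) le_rfl
        rw [hLi, hk, hN l hl, Matrix.mulVec_neg, Matrix.mulVec_mulVec, neg_add_cancel]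
        rfl
      · intro p _ hp
        rcases lt_or_ge l p with h1 | h1
        · rw [htri l p h1 hp.2, Matrix.zero_mulVec]
        · rw [hL0 z p (lt_of_le_of_ne (h1.trans hl) hp.2) hp.1, Matrix.mulVec_zero]
      · simp
      · simp)
  rw [card_subtype_le_fst] at key
  have h3 := LinearMap.finrank_range_add_finrank_ker (blockMat F).mulVecLin
  rw [finrank_fintype_fun_eq_card] at h3
  rw [Matrix.rank]
  omega

theorem pow_apply_eq_zero {r : ℕ} {K : Matrix (Fin r) (Fin r) ℂ}
    (hK : ∀ i j, j < i → K i j = 0) (j : ℕ) {p l : Fin r} (h : l < p) : (K ^ j) p l = 0 := by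
  have hK' : K.IsUpperTriangular := fun i j hij => hK i j hij
  exact (Matrix.BlockTriangular.pow hK' j) h

theorem pow_apply_self {r : ℕ} {K : Matrix (Fin r) (Fin r) ℂ}
    (hK : ∀ i j, j < i → K i j = 0) (j : ℕ) (p : Fin r) : (K ^ j) p p = K p p ^ j := by
  induction j with
  | zero => simp
  | succ j ih =>
    rw [pow_succ', pow_succ', Matrix.mul_apply, Finset.sum_eq_single p, ih]
    · intro q _ hq
      rcases lt_or_gt_of_ne hq with h | h
      · rw [hK _ _ h, zero_mul]
      · rw [pow_apply_eq_zero hK j h, mul_zero]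
    · simp

/-- For triangular `K`, entry `(p, l)` of a power is a sum over increasing paths from `p` to `l`, so
it only sees entries of `K` at most as far from the diagonal as `(p, l)` itself. -/
theorem norm_pow_apply_le {r d : ℕ} {K : Matrix (Fin r) (Fin r) ℂ} {b : ℝ} (hb : 0 ≤ b)
    (hK : ∀ i j, j < i → K i j = 0)
    (h : ∀ p l : Fin r, p ≤ l → (l : ℕ) < p + d → ‖K p l‖ ≤ b) (j : ℕ) :
    ∀ p l : Fin r, p ≤ l → (l : ℕ) < p + d → ‖(K ^ j) p l‖ ≤ (r * b) ^ j := by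
  induction j with
  | zero =>
    intro p l _ _
    rw [pow_zero, pow_zero, Matrix.one_apply]
    split_ifs <;> simp
  | succ j ih =>
    intro p l hpl hd
    have hterm : ∀ q ∈ Finset.univ, ‖K p q * (K ^ j) q l‖ ≤ b * (r * b) ^ j := by
      intro q _
      rcases lt_or_ge q p with h1 | h1
      · rw [hK _ _ h1, zero_mul, norm_zero]
        positivity
      · rcases lt_or_ge l q with h2 | h2
        · rw [pow_apply_eq_zero hK j h2, mul_zero, norm_zero]
          positivity
        · have h1' : (p : ℕ) ≤ q := h1
          have h2' : (q : ℕ) ≤ l := h2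
          rw [norm_mul]
          exact mul_le_mul (h p q h1 (by omega)) (ih q l h2 (by omega)) (norm_nonneg _) hb
    rw [pow_succ', Matrix.mul_apply]
    refine (norm_sum_le_of_le _ hterm).trans (le_of_eq ?_)
    rw [Finset.sum_const, Finset.card_univ, Fintype.card_fin, nsmul_eq_mul]
    ring

theorem sum_range_eq_telescope (x y : ℂ) (j : ℕ) :
    ∑ i ∈ Finset.range j, x ^ i * y ^ (j - 1 - i) = telescope x 1 y j := by
  induction j with
  | zero => rfl
  | succ j ih =>
    rw [telescope, ← ih, Finset.sum_range_succ', Finset.mul_sum]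
    have h : ∀ i ∈ Finset.range j, x ^ (i + 1) * y ^ (j + 1 - 1 - (i + 1)) =
        x * (x ^ i * y ^ (j - 1 - i)) := fun i _ => by
      rw [pow_succ', mul_assoc, show j + 1 - 1 - (i + 1) = j - 1 - i by omega]
    rw [Finset.sum_congr rfl h]
    simp

/-- Along increasing paths from `i` to `k`, the entry `K i k` is used at most once, with all other
steps staying at `i` or `k`. Its coefficient is the divided difference of `x^j` at the two diagonal
entries; all other paths use entries nearer the diagonal. -/
theorem norm_pow_apply_sub_le {r d : ℕ} {K : Matrix (Fin r) (Fin r) ℂ} {b : ℝ} (hb : 0 ≤ b)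
    (hK : ∀ i j, j < i → K i j = 0)
    (h : ∀ p l : Fin r, p ≤ l → (l : ℕ) < p + d → ‖K p l‖ ≤ b) {i k : Fin r} (hik : i < k)
    (hd : (k : ℕ) = i + d) (j : ℕ) :
    ‖(K ^ j) i k - K i k * telescope (K i i) 1 (K k k) j‖ ≤ j * (r * b) ^ j := by
  have hr : (1 : ℝ) ≤ r := by
    have := i.2
    exact_mod_cast (by omega : 1 ≤ r)
  have hik' : (i : ℕ) < k := hik
  induction j with
  | zero => simp [telescope, Matrix.one_apply_ne hik.ne]
  | succ j ih =>
    have hsplit : (K ^ (j + 1)) i k - K i k * telescope (K i i) 1 (K k k) (j + 1) =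
        K i i * ((K ^ j) i k - K i k * telescope (K i i) 1 (K k k) j) +
          ∑ q ∈ Finset.univ \ {i, k}, K i q * (K ^ j) q k := by
      rw [pow_succ', Matrix.mul_apply, ← Finset.sum_sdiff (Finset.subset_univ {i, k}),
        Finset.sum_pair hik.ne, telescope, pow_apply_self hK]
      ring
    have hterm : ∀ q ∈ Finset.univ \ {i, k}, ‖K i q * (K ^ j) q k‖ ≤ b * (r * b) ^ j := by
      intro q hq
      have hq1 : q ≠ i := fun he => by simp [he] at hq
      have hq2 : q ≠ k := fun he => by simp [he] at hq
      rcases lt_or_gt_of_ne hq1 with h1 | h1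
      · rw [hK _ _ h1, zero_mul, norm_zero]
        positivity
      · rcases lt_or_gt_of_ne hq2 with h2 | h2
        · have h1' : (i : ℕ) < q := h1
          have h2' : (q : ℕ) < k := h2
          rw [norm_mul]
          exact mul_le_mul (h i q h1.le (by omega))
            (norm_pow_apply_le hb hK h j q k h2.le (by omega)) (norm_nonneg _) hb
        · rw [pow_apply_eq_zero hK j h2, mul_zero, norm_zero]
          positivity
    have hsum : ‖∑ q ∈ Finset.univ \ {i, k}, K i q * (K ^ j) q k‖ ≤ r * (b * (r * b) ^ j) := by
      refine (norm_sum_le_of_le _ hterm).trans ?_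
      rw [Finset.sum_const, nsmul_eq_mul]
      gcongr
      calc (Finset.univ \ {i, k}).card ≤ (Finset.univ : Finset (Fin r)).card :=
            Finset.card_le_card (Finset.subset_univ _)
        _ = r := by simp
    have hii : ‖K i i‖ ≤ r * b :=
      (h i i le_rfl (by omega)).trans (le_mul_of_one_le_left hb hr)
    rw [hsplit]
    refine (norm_add_le _ _).trans ((add_le_add ((norm_mul_le _ _).trans
      (mul_le_mul hii ih (norm_nonneg _) (by positivity))) hsum).trans (le_of_eq ?_))
    push_cast
    ring

theorem exists_norm_toEuclideanCLM_le (ι : Type) [Fintype ι] [DecidableEq ι] :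
    ∃ c : ℝ, 0 ≤ c ∧ ∀ (B : Matrix ι ι ℂ) (M : ℝ), 0 ≤ M → (∀ i j, ‖B i j‖ ≤ M) →
      ‖Matrix.toEuclideanCLM (n := ι) (𝕜 := ℂ) B‖ ≤ c * M := by
  let f : (ι → ι → ℂ) →L[ℂ] (EuclideanSpace ℂ ι →L[ℂ] EuclideanSpace ℂ ι) :=
    LinearMap.toContinuousLinearMap
      ((Matrix.toEuclideanCLM (n := ι) (𝕜 := ℂ)).toAlgEquiv.toLinearMap ∘ₗ
        (Matrix.ofLinearEquiv ℂ).toLinearMap)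
  refine ⟨‖f‖, norm_nonneg f, fun B M hM h => ?_⟩
  refine (f.le_opNorm (fun i j => B i j)).trans (mul_le_mul_of_nonneg_left ?_ (norm_nonneg f))
  exact (pi_norm_le_iff_of_nonneg hM).2 fun i => (pi_norm_le_iff_of_nonneg hM).2 (h i)

theorem Cmat_self {r : ℕ} (μ : Fin r → ℂ) (Γ : StrictUpper r → ℂ) (i : Fin r) :
    Cmat μ Γ i i = μ i := by
  simp [Cmat]

/-- If the entries of `C(μ, Γ)` closer to the diagonal than position `(i, k)` are bounded, then
`σ_{-r}(Q)` is bounded by a constant multiple of the inverse of the entry `(i, k)`. -/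
theorem exists_sigmaNeg_mul_le {n m r : ℕ} (hrn : r ≤ n)
    (A : Fin (m + 1) → Matrix (Fin n) (Fin n) ℂ) (μ : Fin r → ℂ) {i k : Fin r} (hik : i < k)
    (hD : IsUnit (divDiff A (μ i) (μ k)).det) {d : ℕ} (hd : (k : ℕ) = i + d) {b : ℝ} (hb : 0 ≤ b) :
    ∃ M : ℝ, ∀ Γ : StrictUpper r → ℂ,
      (∀ p l : Fin r, p ≤ l → (l : ℕ) < p + d → ‖Cmat μ Γ p l‖ ≤ b) →
        sigmaNeg r (Qmat A μ Γ) * ‖Cmat μ Γ i k‖ ≤ M := by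
  obtain ⟨c, hc, hcM⟩ := exists_norm_toEuclideanCLM_le (Fin r × Fin n)
  set D := divDiff A (μ i) (μ k) with hDdef
  -- With `γ = K i k`, block `(k, i)` of `Q` is `γ D` plus a bounded term, and `D N` is the diagonal
  -- block `P(μ_k)`. So block column `i` times `γ⁻¹ N` reproduces block column `k`, in block rows up
  -- to `k`, with an error `γ⁻¹ G l * N`. Adding this error to `Q` makes `rank_blockMat_add_le`
  -- applicable.
  set N := D⁻¹ * ∑ j : Fin (m + 1), μ k ^ (j : ℕ) • A j with hNdef
  let g : Fin n → Fin n → ℝ := fun a e =>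
    ∑ j : Fin (m + 1), ((j : ℕ) + 1 : ℝ) * (r * b) ^ (j : ℕ) * ‖A j a e‖
  have hg : ∀ a e, 0 ≤ g a e := fun a e => Finset.sum_nonneg fun j _ => by positivity
  let M : ℝ := ∑ a, ∑ f, ∑ e, g a e * ‖N e f‖
  have hM : ∀ a f, ∑ e, g a e * ‖N e f‖ ≤ M := by
    intro a f
    have h0 : ∀ a f, 0 ≤ ∑ e, g a e * ‖N e f‖ := fun a f =>
      Finset.sum_nonneg fun e _ => mul_nonneg (hg a e) (norm_nonneg _)
    exact (Finset.single_le_sum (f := fun f => ∑ e, g a e * ‖N e f‖) (fun f _ => h0 a f)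
      (Finset.mem_univ f)).trans (Finset.single_le_sum
        (f := fun a => ∑ f, ∑ e, g a e * ‖N e f‖)
        (fun a _ => Finset.sum_nonneg fun f _ => h0 a f) (Finset.mem_univ a))
  have hM0 : 0 ≤ M := Finset.sum_nonneg fun a _ => Finset.sum_nonneg fun f _ =>
    Finset.sum_nonneg fun e _ => mul_nonneg (hg a e) (norm_nonneg _)
  refine ⟨c * M, fun Γ hΓ => ?_⟩
  set K := Cmat μ Γ with hKdef
  have hK : ∀ i j, j < i → K i j = 0 := fun _ _ => Cmat_upper μ Γ
  have hKs : ∀ p, K p p = μ p := Cmat_self μ Γ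
  set γ := K i k with hγ
  by_cases hγ0 : γ = 0
  · rw [hγ0, norm_zero, mul_zero]
    positivity
  -- the bounded part of block column `i`
  let G : Fin r → Matrix (Fin n) (Fin n) ℂ := fun l =>
    ∑ j : Fin (m + 1),
      ((K ^ (j : ℕ)) i l - if l = k then γ * telescope (μ i) 1 (μ k) (j : ℕ) else 0) • A j
  have hGk : Qblock A K k i = γ • D + G k := by
    simp only [Qblock, G, hDdef, divDiff, sum_range_eq_telescope, if_true, Finset.smul_sum,
      ← Finset.sum_add_distrib, smul_smul, ← add_smul, add_sub_cancel]
  have hGl : ∀ l ≠ k, Qblock A K l i = G l := by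
    intro l hl
    simp only [Qblock, G, if_neg hl, sub_zero]
  have hGbound : ∀ l ≤ k, ∀ a e, ‖G l a e‖ ≤ g a e := by
    intro l hl a e
    simp only [G, Matrix.sum_apply]
    refine norm_sum_le_of_le _ fun j _ => ?_
    rw [Matrix.smul_apply, smul_eq_mul, norm_mul]
    refine mul_le_mul_of_nonneg_right ?_ (norm_nonneg _)
    have hpos : (0 : ℝ) ≤ (r * b) ^ (j : ℕ) := by positivity
    rcases hl.lt_or_eq with h1 | rfl
    · rw [if_neg h1.ne, sub_zero]
      rcases lt_or_ge l i with h2 | h2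
      · rw [pow_apply_eq_zero hK _ h2, norm_zero]
        positivity
      · have h1' : (l : ℕ) < k := h1
        refine (norm_pow_apply_le hb hK hΓ _ i l h2 (by omega)).trans ?_
        have : (0 : ℝ) ≤ ((j : ℕ) : ℝ) := Nat.cast_nonneg _
        nlinarith
    · rw [if_pos rfl]
      have := norm_pow_apply_sub_le hb hK hΓ hik hd j
      rw [hKs, hKs] at this
      refine this.trans ?_
      nlinarith
  let F : Fin r → Fin r → Matrix (Fin n) (Fin n) ℂ := fun l p =>
    if p = k ∧ l ≤ k then G l * N else 0
  have hFbound : ∀ x y, ‖blockMat F x y‖ ≤ M := by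
    rintro ⟨l, a⟩ ⟨p, f⟩
    change ‖F l p a f‖ ≤ M
    by_cases h : p = k ∧ l ≤ k
    · simp only [F, if_pos h]
      rw [Matrix.mul_apply]
      refine le_trans (norm_sum_le_of_le _ fun e _ => ?_) (hM a f)
      rw [norm_mul]
      exact mul_le_mul_of_nonneg_right (hGbound l h.2 a e) (norm_nonneg _)
    · simp only [F, if_neg h, Matrix.zero_apply, norm_zero]
      exact hM0
  have hsum : Qmat A μ Γ + γ⁻¹ • blockMat F =
      blockMat fun l p => Qblock A K l p + γ⁻¹ • F l p := by
    rw [Qmat_eq_blockMat]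
    rfl
  have hle := sigmaNeg_le_of_rank_add_le (Qmat A μ Γ) (γ⁻¹ • blockMat F) (k := r)
    (s := ‖γ‖⁻¹ * (c * M)) (by positivity) (by
      have hDN : D * N = Qblock A K k k := by
        rw [hNdef, ← Matrix.mul_assoc, Matrix.mul_nonsing_inv _ hD, Matrix.one_mul, Qblock]
        refine Finset.sum_congr rfl fun j _ => ?_
        rw [pow_apply_self hK, hKs]
      refine le_trans (Nat.add_le_add_left hrn _) ?_
      rw [hsum]
      refine rank_blockMat_add_le _ hik (γ⁻¹ • N) ?_ ?_
      · intro l p hlp hpk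
        have h1 : Qblock A K l p = 0 := Finset.sum_eq_zero fun j _ => by
          rw [pow_apply_eq_zero hK _ hlp, zero_smul]
        have h2 : F l p = 0 := if_neg fun h => hpk h.1
        rw [h1, h2, smul_zero, add_zero]
      · intro l hl
        have h1 : F l k = G l * N := if_pos ⟨rfl, hl⟩
        have h2 : F l i = 0 := if_neg fun h => hik.ne h.1
        rw [h1, h2, smul_zero, add_zero, Matrix.mul_smul]
        rcases hl.lt_or_eq with h3 | rfl
        · have h4 : Qblock A K l k = 0 := Finset.sum_eq_zero fun j _ => by
            rw [pow_apply_eq_zero hK _ h3, zero_smul]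
          rw [h4, zero_add, hGl l h3.ne]
        · rw [hGk, Matrix.add_mul, smul_add, Matrix.smul_mul, smul_smul, inv_mul_cancel₀ hγ0,
            one_smul, hDN])
    (by
      intro x
      rw [map_smul, LinearMap.smul_apply, norm_smul, norm_inv, mul_assoc]
      refine mul_le_mul_of_nonneg_left ?_ (by positivity)
      rw [← Matrix.coe_toEuclideanCLM_eq_toEuclideanLin]
      exact ((Matrix.toEuclideanCLM (n := Fin r × Fin n) (𝕜 := ℂ) (blockMat F)).le_opNorm x).trans
        (mul_le_mul_of_nonneg_right (hcM _ _ hM0 hFbound) (norm_nonneg x)))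
  have hγpos : 0 < ‖γ‖ := norm_pos_iff.2 hγ0
  calc sigmaNeg r (Qmat A μ Γ) * ‖γ‖ ≤ ‖γ‖⁻¹ * (c * M) * ‖γ‖ :=
        mul_le_mul_of_nonneg_right hle hγpos.le
    _ = c * M := by field_simp

/-- Induction on the distance from the diagonal: once nearer entries are bounded, `σ_{-r}(Q) ‖γ‖ ≤
M` together with `ε ≤ σ_{-r}(Q)` bounds the next superdiagonal. The diagonal itself is the fixed
`μ`. -/
theorem exists_entry_bound {n m r : ℕ} (hrn : r ≤ n)
    (A : Fin (m + 1) → Matrix (Fin n) (Fin n) ℂ) (μ : Fin r → ℂ)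
    (hD : ∀ k l : Fin r, k < l → IsUnit (divDiff A (μ k) (μ l)).det) {ε : ℝ} (hε : 0 < ε) (d : ℕ) :
    ∃ b : ℝ, 0 ≤ b ∧ ∀ Γ : StrictUpper r → ℂ, ε ≤ sigmaNeg r (Qmat A μ Γ) →
      ∀ p l : Fin r, p ≤ l → (l : ℕ) < p + d → ‖Cmat μ Γ p l‖ ≤ b := by
  induction d with
  | zero => exact ⟨0, le_rfl, fun Γ _ p l h1 h2 => absurd h1 (by simpa using h2)⟩
  | succ d ih =>
    obtain ⟨b, hb, ih⟩ := ih
    have hex : ∀ i k : Fin r, ∃ c : ℝ, ∀ Γ : StrictUpper r → ℂ, ε ≤ sigmaNeg r (Qmat A μ Γ) →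
        i ≤ k → (k : ℕ) = i + d → ‖Cmat μ Γ i k‖ ≤ c := by
      intro i k
      by_cases h : i < k ∧ (k : ℕ) = i + d
      · obtain ⟨M, hM⟩ := exists_sigmaNeg_mul_le hrn A μ h.1 (hD i k h.1) h.2 hb
        refine ⟨M / ε, fun Γ hΓ _ _ => ?_⟩
        rw [le_div_iff₀ hε, mul_comm]
        exact (mul_le_mul_of_nonneg_right hΓ (norm_nonneg _)).trans (hM Γ (ih Γ hΓ))
      · refine ⟨‖μ i‖, fun Γ _ h1 h2 => ?_⟩
        have : i = k := by
          by_contra hne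
          exact h ⟨lt_of_le_of_ne h1 hne, h2⟩
        rw [← this, Cmat_self]
    choose c hc using hex
    refine ⟨b + ∑ i, ∑ k, |c i k|, by positivity, fun Γ hΓ p l h1 h2 => ?_⟩
    rcases Nat.lt_or_ge (l : ℕ) (p + d) with h3 | h3
    · exact (ih Γ hΓ p l h1 h3).trans (le_add_of_nonneg_right (by positivity))
    · have h4 := hc p l Γ hΓ h1 (by omega)
      have h5 : |c p l| ≤ ∑ i, ∑ k, |c i k| :=
        (Finset.single_le_sum (f := fun k => |c p k|) (fun _ _ => abs_nonneg _)
          (Finset.mem_univ l)).trans (Finset.single_le_sum (f := fun i => ∑ k, |c i k|)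
            (fun _ _ => Finset.sum_nonneg fun _ _ => abs_nonneg _) (Finset.mem_univ p))
      linarith [le_abs_self (c p l)]

theorem continuous_sigmaNeg_Qmat {n m r : ℕ} (A : Fin (m + 1) → Matrix (Fin n) (Fin n) ℂ)
    (μ : Fin r → ℂ) (k : ℕ) : Continuous fun Γ => sigmaNeg k (Qmat A μ Γ) := by
  have h1 : Continuous fun Γ : StrictUpper r → ℂ => Cmat μ Γ := by
    refine continuous_matrix fun i j => ?_
    simp only [Cmat, Matrix.of_apply]
    split_ifs <;> fun_prop
  have h2 : Continuous fun Γ => Qmat A μ Γ :=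
    continuous_finsetSum _ fun j _ => (continuous_kronecker_right (A j)).comp
      (h1.pow (j : ℕ)).matrix_transpose
  simp only [sigmaNeg_eq]
  exact (continuous_singularValues _).comp (continuous_toEuclideanCLM.comp h2)

theorem sigmaNeg_nonneg {ι : Type} [Fintype ι] [DecidableEq ι] (k : ℕ) (B : Matrix ι ι ℂ) :
    0 ≤ sigmaNeg k B := LinearMap.singularValues_nonneg _ _

theorem exists_attainedAt {n m r : ℕ} (hrn : r ≤ n)
    (A : Fin (m + 1) → Matrix (Fin n) (Fin n) ℂ) (μ : Fin r → ℂ)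
    (hD : ∀ k l : Fin r, k < l → IsUnit (divDiff A (μ k) (μ l)).det) :
    ∃ Γ : StrictUpper r → ℂ, AttainedAt A μ Γ := by
  have hmax : ∃ Γ, ∀ Γ', sigmaNeg r (Qmat A μ Γ') ≤ sigmaNeg r (Qmat A μ Γ) := by
    -- Either some value is positive, and its superlevel set is bounded, or the function is
    -- identically zero and any `Γ` is a maximizer.
    by_cases h0 : ∃ Γ, 0 < sigmaNeg r (Qmat A μ Γ)
    · obtain ⟨Γ₀, hΓ₀⟩ := h0
      obtain ⟨b, hb, hbound⟩ := exists_entry_bound hrn A μ hD hΓ₀ r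
      refine (continuous_sigmaNeg_Qmat A μ r).exists_forall_ge' Γ₀ ?_
      filter_upwards [(isCompact_closedBall (0 : StrictUpper r → ℂ) b).compl_mem_cocompact]
        with Γ hΓ
      by_contra! hlt
      refine hΓ ?_
      rw [mem_closedBall_zero_iff, pi_norm_le_iff_of_nonneg hb]
      rintro ⟨⟨i, k⟩, hik⟩
      have hik' : i < k := hik
      have h := hbound Γ hlt.le i k hik'.le (by have := k.2; omega)
      simpa [Cmat, hik', hik'.ne] using h
    · push Not at h0
      exact ⟨0, fun Γ' => (h0 Γ').trans (sigmaNeg_nonneg _ _)⟩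
  obtain ⟨Γ, hΓ⟩ := hmax
  exact ⟨Γ, le_antisymm (iSup_le fun Γ' => ENNReal.ofReal_le_ofReal (hΓ Γ'))
    (le_iSup (fun Γ' => ENNReal.ofReal (sigmaNeg r (Qmat A μ Γ'))) Γ)⟩

end Attainment

/-! ### Assembling the two bounds. -/

theorem norm2_smul {n : ℕ} (c : ℂ) (B : Matrix (Fin n) (Fin n) ℂ) :
    norm2 (c • B) = ‖c‖ * norm2 B := by
  rw [norm2, map_smul, norm_smul, norm2]

theorem iInf_kappa_le_tau {n m r : ℕ} (hr : 0 < r) (A : Fin (m + 1) → Matrix (Fin n) (Fin n) ℂ)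
    (S : Finset ℂ) : (⨅ (ν : Fin r → ℂ) (_ : ∀ i, ν i ∈ S), kappa A ν) ≤ tau A S r := by
  refine le_iInf₂ fun Δ hΔ => ?_
  obtain ⟨ν, hν, h⟩ := exists_sigmaNeg_le_of_feasible hr A S Δ hΔ
  exact (iInf₂_le ν hν).trans (iSup_le fun Γ => ENNReal.ofReal_le_ofReal (h Γ))

theorem toReal_kappa {n m r : ℕ} {A : Fin (m + 1) → Matrix (Fin n) (Fin n) ℂ} {μ : Fin r → ℂ}
    {Γ : StrictUpper r → ℂ} (h : AttainedAt A μ Γ) :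
    (kappa A μ).toReal = sigmaNeg r (Qmat A μ Γ) := by
  rw [h, ENNReal.toReal_ofReal (sigmaNeg_nonneg _ _)]

theorem feasible_optPert {n m r : ℕ} (hm : 0 < m) {A : Fin (m + 1) → Matrix (Fin n) (Fin n) ℂ}
    (hA : (A (Fin.last m)).rank = n) {S : Finset ℂ} {μ : Fin r → ℂ} (hμ : ∀ i, μ i ∈ S)
    {Γ : StrictUpper r → ℂ} {U V : Matrix (Fin n) (Fin r) ℂ} (hatt : AttainedAt A μ Γ)
    (hpair : SingularPair (Qmat A μ Γ) (sigmaNeg r (Qmat A μ Γ)) U V) (hV : V.rank = r) :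
    Feasible A S r (optPert A μ U V) := by
  refine feasible_of_charpoly_dvd A S _ (det_matPoly_add_ne_zero hm A hA _) μ hμ ?_
  rw [← charpoly_Cmat μ Γ]
  refine charpoly_dvd_det_of_invariantPair A _ V _ hV ?_
  have h := hpair.2.2.1
  rw [Qmat_mulVec_vec, ← Matrix.vec_smul, Matrix.vec_inj] at h
  rw [h, optPert, toReal_kappa hatt, Matrix.neg_mul, Matrix.smul_mul, Matrix.mul_assoc,
    pinv_mul_self V hV, Matrix.mul_one, add_neg_cancel]

theorem norm2_optPert_le {n m r : ℕ} (hr : 0 < r) {A : Fin (m + 1) → Matrix (Fin n) (Fin n) ℂ}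
    {μ : Fin r → ℂ} {Γ : StrictUpper r → ℂ} {U V : Matrix (Fin n) (Fin r) ℂ}
    (hatt : AttainedAt A μ Γ)
    (hpair : SingularPair (Qmat A μ Γ) (sigmaNeg r (Qmat A μ Γ)) U V)
    (hmult : singValMult (Qmat A μ Γ) (sigmaNeg r (Qmat A μ Γ)) = 1) (hV : V.rank = r) :
    norm2 (optPert A μ U V) ≤ sigmaNeg r (Qmat A μ Γ) := by
  have hs := sigmaNeg_nonneg r (Qmat A μ Γ)
  rw [optPert, toReal_kappa hatt, ← neg_smul, norm2_smul, norm_neg, Complex.norm_real,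
    Real.norm_of_nonneg hs]
  -- If the singular value is zero then so is the perturbation; equality of the Gram matrices is
  -- only available, and only needed, in the positive case.
  rcases hs.eq_or_lt with h0 | hpos
  · rw [← h0, zero_mul]
  · have hn : 0 < n := by
      have := V.rank_le_height
      omega
    have hmax : ∀ Γ', sigmaNeg r (Qmat A μ Γ') ≤ sigmaNeg r (Qmat A μ Γ) := fun Γ' =>
      (ENNReal.ofReal_le_ofReal_iff hs).1
        ((le_iSup (fun Γ' => ENNReal.ofReal (sigmaNeg r (Qmat A μ Γ'))) Γ').trans_eq hatt)
    exact mul_le_of_le_one_right hs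
      (norm2_mul_pinv_le_one U V hV (gram_eq hr hn A μ Γ U V hmax hpair hmult hpos))

end SpecEig

theorem theorem3p1 {n m r : ℕ} (hm : 0 < m) (hr : 0 < r)
    (A : Fin (m + 1) → Matrix (Fin n) (Fin n) ℂ) (hA : (A (Fin.last m)).rank = n)
    (S : Finset ℂ) :
    -- for `r ≤ n` and generic `μ` the inner supremum is attained
    (r ≤ n → ∀ μ : Fin r → ℂ,
      (∀ k l : Fin r, k < l → (divDiff A (μ k) (μ l)).rank = n) →
        ∃ Γ : StrictUpper r → ℂ, AttainedAt A μ Γ) ∧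
    -- at an optimal `(μ, Γ)`, under the multiplicity and linear independence assumptions
    (∀ (μ : Fin r → ℂ) (Γ : StrictUpper r → ℂ) (U V : Matrix (Fin n) (Fin r) ℂ),
      OuterOptimal A S μ → AttainedAt A μ Γ →
      SingularPair (Qmat A μ Γ) (sigmaNeg r (Qmat A μ Γ)) U V →
      singValMult (Qmat A μ Γ) (sigmaNeg r (Qmat A μ Γ)) = 1 →
      V.rank = r →
        tau A S r = (⨅ (ν : Fin r → ℂ) (_ : ∀ i, ν i ∈ S), ⨆ Γ' : StrictUpper r → ℂ,
          ENNReal.ofReal (sigmaNeg r (Qmat A ν Γ'))) ∧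
        Feasible A S r (optPert A μ U V) ∧
        ENNReal.ofReal (norm2 (optPert A μ U V)) = tau A S r ∧
        ∀ Δ : Matrix (Fin n) (Fin n) ℂ, Feasible A S r Δ → norm2 (optPert A μ U V) ≤ norm2 Δ) := by
  refine ⟨fun hrn μ hD => exists_attainedAt hrn A μ fun k l hkl => isUnit_det_of_rank_eq (hD k l hkl),
    fun μ Γ U V hopt hatt hpair hmult hV => ?_⟩
  have hfeas := feasible_optPert hm hA hopt.1 hatt hpair hV
  have hinf : (⨅ (ν : Fin r → ℂ) (_ : ∀ i, ν i ∈ S), kappa A ν) = kappa A μ :=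
    le_antisymm (iInf₂_le μ hopt.1) (le_iInf₂ hopt.2)
  -- The cycle `κ(μ) ≤ τ ≤ ‖Δ_*‖ ≤ κ(μ)` makes all three quantities equal.
  have h1 : kappa A μ ≤ tau A S r := hinf ▸ iInf_kappa_le_tau hr A S
  have h2 : tau A S r ≤ ENNReal.ofReal (norm2 (optPert A μ U V)) := iInf₂_le _ hfeas
  have h3 : ENNReal.ofReal (norm2 (optPert A μ U V)) ≤ kappa A μ :=
    (ENNReal.ofReal_le_ofReal (norm2_optPert_le hr hatt hpair hmult hV)).trans_eq hatt.symm
  have h4 : ENNReal.ofReal (norm2 (optPert A μ U V)) = tau A S r := le_antisymm (h3.trans h1) h2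
  refine ⟨(le_antisymm (h2.trans h3) h1).trans hinf.symm, hfeas, h4, fun Δ hΔ => ?_⟩
  rw [← ENNReal.ofReal_le_ofReal_iff (norm2_nonneg Δ), h4]
  exact iInf₂_le Δ hΔ
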